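/- **Setting.** Let $n,p\ge 1$, let $\mathbf X$ be a fixed $n\times p$ real design matrix with rows $\mathbf x_1^\top,\dots,\mathbf x_n^\top$, and for $\beta\in\mathbb R^p$ put $p_i=(1+e^{-\mathbf x_i^\top\beta})^{-1}$. The counts $y=(y_1,\dots,y_n)$ are independent and follow one of two Type II models with known sizes $m_i$: Binomial, $p(y_i\mid\mathbf x_i,\beta)=\binom{m_i}{y_i}p_i^{y_i}(1-p_i)^{m_i-y_i}$ with $m_i\in\{1,2,\dots\}$ (set $a_i=y_i$, $b_i=m_i$); or Negative-Binomial, $p(y_i\mid\mathbf x_i,\beta)=\binom{y_i+m_i-1}{y_i}p_i^{m_i}(1-p_i)^{y_i}$, $y_i\in\{0,1,2,\dots\}$, with real $m_i>0$ (set $a_i=m_i$, $b_i=y_i+m_i$). In both cases $p(y_i\mid \mathbf x_i,\beta)\propto e^{a_i\mathbf x_i^\top\beta}/(1+e^{\mathbf x_i^\top\beta})^{b_i}$. Write $p(y\mid\mathbf X,\beta)=\prod_i p(y_i\mid\mathbf x_i,\beta)$ and let $\mathbb P_{\beta}$ be the law of $y$ under $\beta$. Let $h(t)=-\log[2\cosh(\sqrt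 t/2)]$ for $t\ge 0$, $A(\xi)=h'(\xi^2)$ (one-sided derivative at $0$), $\gamma(\xi)=h(\xi^2)-\xi^2h'(\xi^2)$. For $\alpha\in(0,1)$ and $\xi\in[0,\infty)^n$ let $$\varphi_\alpha(y\mid\mathbf X,\beta,\xi)=\Big\{\prod_{i=1}^n\exp\big[(a_i-\tfrac{b_i}{2})\mathbf x_i^\top\beta+b_iA(\xi_i)(\mathbf x_i^\top\beta)^2+b_i\gamma(\xi_i)\big]\Big\}^{\alpha}.$$ Let the prior be $\pi=\mathcal N_p(\mu,\Sigma)$ with $\Sigma$ positive definite, let $\varphi_\alpha(y\mid\mathbf X,\xi)=\int\varphi_\alpha(y\mid\mathbf X,\beta,\xi)\,\pi(d\beta)$, and let the variational posterior be $\pi_\alpha(d\beta\mid\mathcal D_n,\xi)=\varphi_\alpha(y\mid\mathbf X,\beta,\xi)\,\pi(d\beta)/\varphi_\alpha(y\mid\mathbf X,\xi)$, where $\mathcal D_n$ denotes the data $(\mathbf X,y)$. An optimal variational parameter $\xi^\star$ is a maximizer over $[0,\infty)^n$ of $\mathsf L(\xi)=\log\varphi_\alpha(y\mid\mathbf X,\xi)$.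 Finally let $$D_\alpha(\beta,\beta_0)=\frac{1}{n(\alpha-1)}\log\sum_{y}p(y\mid\mathbf X,\beta)^{\alpha}\,p(y\mid\mathbf X,\beta_0)^{1-\alpha}.$$ **Theorem.** For every $p\ge1$, $\mu\in\mathbb R^p$, positive definite $\Sigma\in\mathbb R^{p\times p}$, $\beta_0\in\mathbb R^p$ and bounds $R,\mathbf m^\star\in\mathbb R$ there is a constant $C_2>0$, depending only on these, such that the following holds for every $n\ge 1$, every design $\mathbf X$ with $\max_i\|\mathbf x_i\|_2\le R$, every Binomial or Negative-Binomial model as above with $\max_i m_i\le\mathbf m^\star$, every $\alpha\in(0,1)$, every $\varepsilon_n\in(0,\tfrac13)$ and every $D>1$. With $\mathbb P_{\beta_0}$-probability at least $1-2\varepsilon_n-[(D-1)^2n\varepsilon_n^2]^{-1}$, an optimal variational parameter exists, and for every optimal $\xi^\star$ the function $\beta\mapsto D_\alpha(\beta,\beta_0)$ is integrable with respect to $\pi_\alpha(\cdot\mid\mathcal D_n,\xi^\star)$ and $$(1-\alpha)\int_{\mathbb R^p}D_\alpha(\beta,\beta_0)\,\pi_\alpha(d\beta\mid\mathcal D_n,\xi^\star)\le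 D\alpha\varepsilon_n^2+\frac{p\log p}{n}+C_2\,\frac pn\log\frac1{\varepsilon_n}.$$ -/

import Mathlib

open MeasureTheory ProbabilityTheory Set

namespace SSG

noncomputable section

/-- The two Type II regression models for `n` counts, with their (known) size parameters:
Binomial with `m i` trials, or Negative-Binomial with real size `m i`. -/
inductive CountModel (n : ℕ) where
  | binomial (m : Fin n → ℕ)
  | negBinomial (m : Fin n → ℝ)

variable {n p : ℕ}

/-- The size parameters `m i`, as real numbers. -/
def CountModel.size : CountModel n → Fin n → ℝ
  | .binomial m, i => (m i : ℝ)
  | .negBinomial m, i => m i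

/-- The probability that the `i`-th count equals `k`, when the linear predictor `⟪x i, β⟫` is `z`.
The success probability is `(1 + exp (-z))⁻¹` in both models, and the Negative-Binomial coefficient
is the generalized binomial coefficient `(k + m i - 1).choose k`. -/
def CountModel.pmf : CountModel n → Fin n → ℝ → ℕ → ℝ
  | .binomial m, i, z, k =>
      ((m i).choose k : ℝ) * Real.sigmoid z ^ k * (1 - Real.sigmoid z) ^ (m i - k)
  | .negBinomial m, i, z, k =>
      Ring.choose (m i + k - 1) k * Real.sigmoid z ^ (m i) * (1 - Real.sigmoid z) ^ k

/-- The coefficient `a i` (as a function of the observed count `k`) in the Type II form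
`p(k ∣ z) ∝ exp (a z) / (1 + exp z) ^ b`. -/
def CountModel.coefA : CountModel n → Fin n → ℕ → ℝ
  | .binomial _, _, k => (k : ℝ)
  | .negBinomial m, i, _ => m i

/-- The coefficient `b i` (as a function of the observed count `k`) in the Type II form
`p(k ∣ z) ∝ exp (a z) / (1 + exp z) ^ b`. -/
def CountModel.coefB : CountModel n → Fin n → ℕ → ℝ
  | .binomial m, i, _ => (m i : ℝ)
  | .negBinomial m, i, k => (k : ℝ) + m i

/-- The likelihood `p(y ∣ X, β) = ∏ i, p(y i ∣ x i, β)`, where `X i` is the `i`-th design row. -/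
def likelihood (M : CountModel n) (X : Fin n → EuclideanSpace ℝ (Fin p))
    (β : EuclideanSpace ℝ (Fin p)) (y : Fin n → ℕ) : ℝ :=
  ∏ i, M.pmf i (inner ℝ (X i) β) (y i)

/-- The law of the data `y` under the parameter `β`: independent counts with the given
probability mass functions. -/
def dataLaw (M : CountModel n) (X : Fin n → EuclideanSpace ℝ (Fin p))
    (β : EuclideanSpace ℝ (Fin p)) : Measure (Fin n → ℕ) :=
  Measure.pi fun i =>
    Measure.count.withDensity fun k => ENNReal.ofReal (M.pmf i (inner ℝ (X i) β) k)

/-- The `α`-Rényi divergence per observation,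
`D_α(β, β₀) = (n (α - 1))⁻¹ log ∑ y, p(y ∣ X, β) ^ α p(y ∣ X, β₀) ^ (1 - α)`. -/
def renyiDiv (α : ℝ) (M : CountModel n) (X : Fin n → EuclideanSpace ℝ (Fin p))
    (β β₀ : EuclideanSpace ℝ (Fin p)) : ℝ :=
  1 / (n * (α - 1)) *
    Real.log (∑' y : Fin n → ℕ, likelihood M X β y ^ α * likelihood M X β₀ y ^ (1 - α))

/-- The function `h(t) = - log (2 cosh (√t / 2))`, for `t ≥ 0`. -/
def h (t : ℝ) : ℝ := -Real.log (2 * Real.cosh (√t / 2))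

/-- `A(ξ) = h'(ξ²)`, with the one-sided derivative at `0`. -/
def A (ξ : ℝ) : ℝ := derivWithin h (Ici 0) (ξ ^ 2)

/-- `γ(ξ) = h(ξ²) - ξ² h'(ξ²)`. -/
def gam (ξ : ℝ) : ℝ := h (ξ ^ 2) - ξ ^ 2 * A ξ

/-- The tangent minorizer `φ(y i ∣ x i, β, ξ i)` of the likelihood of one observation; as usual for
Type II likelihoods the factor that depends on the observation only is omitted. -/
def minorizer (M : CountModel n) (i : Fin n) (k : ℕ) (z ξ : ℝ) : ℝ :=
  Real.exp ((M.coefA i k - M.coefB i k / 2) * z + M.coefB i k * A ξ * z ^ 2 + M.coefB i k * gam ξ)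

/-- The fractional working likelihood `φ_α(y ∣ X, β, ξ) = (∏ i, φ(y i ∣ x i, β, ξ i)) ^ α`. -/
def workingLikelihood (α : ℝ) (M : CountModel n) (X : Fin n → EuclideanSpace ℝ (Fin p))
    (y : Fin n → ℕ) (ξ : Fin n → ℝ) (β : EuclideanSpace ℝ (Fin p)) : ℝ :=
  (∏ i, minorizer M i (y i) (inner ℝ (X i) β) (ξ i)) ^ α

/-- The marginal working likelihood `φ_α(y ∣ X, ξ) = ∫ φ_α(y ∣ X, β, ξ) π(dβ)`. -/
def evidence (α : ℝ) (π : Measure (EuclideanSpace ℝ (Fin p))) (M : CountModel n)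
    (X : Fin n → EuclideanSpace ℝ (Fin p)) (y : Fin n → ℕ) (ξ : Fin n → ℝ) : ℝ :=
  ∫ β, workingLikelihood α M X y ξ β ∂π

/-- The `α`-fractional variational posterior
`π_α(dβ ∣ D_n, ξ) = φ_α(y ∣ X, β, ξ) π(dβ) / φ_α(y ∣ X, ξ)`. -/
def posterior (α : ℝ) (π : Measure (EuclideanSpace ℝ (Fin p))) (M : CountModel n)
    (X : Fin n → EuclideanSpace ℝ (Fin p)) (y : Fin n → ℕ) (ξ : Fin n → ℝ) :
    Measure (EuclideanSpace ℝ (Fin p)) :=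
  π.withDensity fun β =>
    ENNReal.ofReal (workingLikelihood α M X y ξ β / evidence α π M X y ξ)

/-- `ξ` is an optimal variational parameter: it has nonnegative coordinates and maximizes the
evidence lower bound `L(ξ) = log φ_α(y ∣ X, ξ)` over all such vectors. -/
def IsOptimal (α : ℝ) (π : Measure (EuclideanSpace ℝ (Fin p))) (M : CountModel n)
    (X : Fin n → EuclideanSpace ℝ (Fin p)) (y : Fin n → ℕ) (ξ : Fin n → ℝ) : Prop :=
  (∀ i, 0 ≤ ξ i) ∧
    IsMaxOn (fun ξ' => Real.log (evidence α π M X y ξ')) {ξ' : Fin n → ℝ | ∀ i, 0 ≤ ξ' i} ξ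

end

end SSG

/-!
# Risk bound for the fractional variational posterior of Type II count models

Write `G(β) = ∏ i, exp (a i z i) / (1 + exp (z i)) ^ b i`, with `z i = ⟪X i, β⟫`, for the part of the
likelihood that depends on `β`, and `S(β) = ∑ y, p(y ∣ β) ^ α p(y ∣ β₀) ^ (1 - α)`, so that
`(1 - α) n D_α(β, β₀) = -log S(β)`. Three facts give the bound.

* *Exponential moment.* The mean of `(G(β) / G(β₀)) ^ α` under `β₀` is `S(β)`. By Tonelli and Markov,
  `∫ S(β)⁻¹ (G(β) / G(β₀)) ^ α dπ ≤ 1 / ε` outside an event of probability `ε`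
  (`lintegral_exp_renyi`).
* *Minorization.* Since `h` is convex, its tangents give `φ_α(β, ξ) ≤ G(β) ^ α`
  (`A_mul_add_gam_le`, `workingLikelihood_le`). Jensen's inequality for the posterior at `ξ` therefore
  bounds `∫ -log S dπ_α` by `log (1 / ε) + α log G(β₀) - log φ_α(y ∣ X, ξ)`.
* *Evidence.* An optimal `ξ` has at least the evidence of `ξ i = |⟪X i, β₀⟫|`, for which the
  minorizer is exact at `β₀`. On the ball of radius `r` around `β₀` the minorizer changes by a factor
  at most `exp (K r ∑ i, b i)`, so the evidence is at least
  `π(ball β₀ r) G(β₀) ^ α exp (-α K r ∑ i, b i)` (`le_evidence`).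

The mean of `∑ i, b i` is of order `n` (`lintegral_sum_coefB_le`). With `r` a small multiple of
`ε ^ 3`, Markov's inequality yields `K r ∑ i, b i ≤ n ε ^ 2` outside a second event of probability
`ε`, while `-log π(ball β₀ r)` is only of order `p log (1 / ε)` (`multivariateGaussian_ball_ge`). This
gives the bound with probability at least `1 - 2 ε`; the remaining terms of the statement are
nonnegative slack.

An optimal `ξ` exists whenever the observation is possible, because the evidence is continuous and
vanishes as `‖ξ‖ → ∞` (`tendsto_evidence`).
-/

/-! ### The function `h` and its tangent lines -/

namespace SSG

open Filter Topology

variable {n p : ℕ}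

/-- The continuous extension of `x ↦ tanh x / x` to the origin, where its value is `1`. -/
noncomputable def tanhc (x : ℝ) : ℝ := dslope Real.tanh 0 x

lemma hasDerivAt_tanh (x : ℝ) : HasDerivAt Real.tanh (1 / Real.cosh x ^ 2) x := by
  have hc : Real.cosh x ≠ 0 := (Real.cosh_pos x).ne'
  have e : Real.tanh = fun y => Real.sinh y / Real.cosh y :=
    funext Real.tanh_eq_sinh_div_cosh
  rw [e]
  refine ((Real.hasDerivAt_sinh x).div (Real.hasDerivAt_cosh x) hc).congr_deriv ?_
  rw [← Real.cosh_sq_sub_sinh_sq x]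
  ring

lemma tanhc_zero : tanhc 0 = 1 := by
  rw [tanhc, dslope_same, (hasDerivAt_tanh 0).deriv]
  simp

lemma tanhc_of_ne {x : ℝ} (hx : x ≠ 0) : tanhc x = Real.tanh x / x := by
  rw [tanhc, dslope_of_ne _ hx, slope_def_field]
  simp

lemma continuous_tanhc : Continuous tanhc := by
  rw [continuous_iff_continuousAt]
  intro x
  rcases eq_or_ne x 0 with rfl | hx
  · exact continuousAt_dslope_same.2 (hasDerivAt_tanh 0).differentiableAt
  · exact (continuousAt_dslope_of_ne hx).2 (hasDerivAt_tanh x).continuousAt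

lemma antitoneOn_tanhc : AntitoneOn tanhc (Ici 0) := by
  have key : ∀ x ∈ interior (Ici (0 : ℝ)),
      HasDerivAt tanhc ((1 / Real.cosh x ^ 2 * x - Real.tanh x * 1) / x ^ 2) x := by
    intro x hx
    rw [interior_Ici] at hx
    have hx' : x ≠ 0 := (mem_Ioi.1 hx).ne'
    refine ((hasDerivAt_tanh x).div (hasDerivAt_id x) hx').congr_of_eventuallyEq ?_
    filter_upwards [isOpen_ne.mem_nhds hx'] with y hy
    exact tanhc_of_ne hy
  refine antitoneOn_of_deriv_nonpos (convex_Ici 0) continuous_tanhc.continuousOn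
    (fun x hx => (key x hx).differentiableAt.differentiableWithinAt) fun x hx => ?_
  rw [(key x hx).deriv]
  rw [interior_Ici] at hx
  have hx0 : 0 < x := hx
  have hc := Real.cosh_pos x
  -- the numerator has the sign of `x - sinh x * cosh x`, and `x ≤ sinh x ≤ sinh x * cosh x`
  have h1 : x ≤ Real.sinh x * Real.cosh x := by
    have h2 := Real.self_le_sinh_iff.2 hx0.le
    nlinarith [Real.one_le_cosh x]
  refine div_nonpos_of_nonpos_of_nonneg ?_ (sq_nonneg x)
  rw [Real.tanh_eq_sinh_div_cosh]
  have : 1 / Real.cosh x ^ 2 * x - Real.sinh x / Real.cosh x * 1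
      = (x - Real.sinh x * Real.cosh x) / Real.cosh x ^ 2 := by
    field_simp
  rw [this]
  exact div_nonpos_of_nonpos_of_nonneg (by linarith) (sq_nonneg _)

lemma tanhc_le_one {x : ℝ} (hx : 0 ≤ x) : tanhc x ≤ 1 :=
  tanhc_zero ▸ antitoneOn_tanhc self_mem_Ici hx hx

lemma tanhc_nonneg {x : ℝ} (hx : 0 ≤ x) : 0 ≤ tanhc x := by
  rcases hx.eq_or_lt with rfl | hx
  · rw [tanhc_zero]; exact zero_le_one
  · rw [tanhc_of_ne hx.ne', Real.tanh_eq_sinh_div_cosh]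
    exact div_nonneg (div_nonneg (Real.sinh_nonneg_iff.2 hx.le) (Real.cosh_pos x).le) hx.le

lemma continuous_h : Continuous h := by
  refine (Continuous.log (continuous_const.mul
    (Real.continuous_cosh.comp (Real.continuous_sqrt.div_const 2))) fun t => ?_).neg
  exact mul_ne_zero two_ne_zero (Real.cosh_pos _).ne'

lemma hasDerivAt_h {t : ℝ} (ht : 0 < t) : HasDerivAt h (-tanhc (√t / 2) / 8) t := by
  have hs : 0 < √t := Real.sqrt_pos.2 ht
  have hc : 2 * Real.cosh (√t / 2) ≠ 0 := by have := Real.cosh_pos (√t / 2); positivity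
  have h1 := ((((Real.hasDerivAt_sqrt ht.ne').div_const 2).cosh.const_mul 2).log hc).neg
  refine h1.congr_deriv ?_
  rw [tanhc_of_ne (by positivity), Real.tanh_eq_sinh_div_cosh]
  have := Real.cosh_pos (√t / 2)
  field_simp
  ring

lemma hasDerivWithinAt_h {t : ℝ} (ht : 0 ≤ t) :
    HasDerivWithinAt h (-tanhc (√t / 2) / 8) (Ici 0) t := by
  rcases ht.eq_or_lt with rfl | ht
  · refine hasDerivWithinAt_Ici_of_tendsto_deriv (s := Ioi 0)
      (fun x hx => (hasDerivAt_h hx).differentiableAt.differentiableWithinAt)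
      continuous_h.continuousWithinAt self_mem_nhdsWithin ?_
    have hc : Continuous fun t : ℝ => -tanhc (√t / 2) / 8 :=
      ((continuous_tanhc.comp (Real.continuous_sqrt.div_const 2)).neg).div_const 8
    refine (hc.continuousWithinAt (s := Ioi 0) (x := 0)).tendsto.congr' ?_
    filter_upwards [self_mem_nhdsWithin] with x hx
    exact (hasDerivAt_h hx).deriv.symm
  · exact (hasDerivAt_h ht).hasDerivWithinAt

lemma A_eq (ξ : ℝ) : A ξ = -tanhc (|ξ| / 2) / 8 := by
  rw [A, (hasDerivWithinAt_h (sq_nonneg ξ)).derivWithin (uniqueDiffOn_Ici 0 _ (sq_nonneg ξ)),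
    Real.sqrt_sq_eq_abs]

lemma continuous_A : Continuous A := by
  rw [show A = fun ξ => -tanhc (|ξ| / 2) / 8 from funext A_eq]
  exact ((continuous_tanhc.comp (continuous_abs.div_const 2)).neg).div_const 8

lemma continuous_gam : Continuous gam :=
  (continuous_h.comp (continuous_pow 2)).sub ((continuous_pow 2).mul continuous_A)

lemma A_nonpos (ξ : ℝ) : A ξ ≤ 0 := by
  rw [A_eq]
  linarith [tanhc_nonneg (show 0 ≤ |ξ| / 2 by positivity)]

lemma abs_A_le (ξ : ℝ) : |A ξ| ≤ 1 / 8 := by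
  rw [abs_of_nonpos (A_nonpos ξ), A_eq]
  linarith [tanhc_le_one (show 0 ≤ |ξ| / 2 by positivity)]

/-- Since `h' = -tanhc (√· / 2) / 8` is nondecreasing, `h` is convex and lies above its tangents. -/
lemma A_mul_add_gam_le (ξ z : ℝ) : A ξ * z ^ 2 + gam ξ ≤ h (z ^ 2) := by
  suffices H : A ξ * (z ^ 2 - ξ ^ 2) ≤ h (z ^ 2) - h (ξ ^ 2) by
    rw [gam]; linarith
  have hA : A ξ = -tanhc (√(ξ ^ 2) / 2) / 8 := by rw [A_eq, Real.sqrt_sq_eq_abs]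
  rw [hA]
  generalize hs : ξ ^ 2 = s
  generalize ht : z ^ 2 = t
  have hs0 : 0 ≤ s := hs ▸ sq_nonneg ξ
  have ht0 : 0 ≤ t := ht ▸ sq_nonneg z
  have mono : ∀ u v : ℝ, u ≤ v → tanhc (√v / 2) ≤ tanhc (√u / 2) := fun u v huv =>
    antitoneOn_tanhc (mem_Ici.2 (by positivity)) (mem_Ici.2 (by positivity))
      (div_le_div_of_nonneg_right (Real.sqrt_le_sqrt huv) two_pos.le)
  rcases lt_trichotomy s t with hst | rfl | hst
  · obtain ⟨c, hc, hc'⟩ := exists_hasDerivAt_eq_slope h (fun t => -tanhc (√t / 2) / 8) hst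
      continuous_h.continuousOn fun x hx => hasDerivAt_h (hs0.trans_lt hx.1)
    rw [eq_div_iff (sub_pos.2 hst).ne'] at hc'
    rw [← hc']
    exact mul_le_mul_of_nonneg_right (by linarith [mono s c hc.1.le]) (sub_pos.2 hst).le
  · simp
  · obtain ⟨c, hc, hc'⟩ := exists_hasDerivAt_eq_slope h (fun t => -tanhc (√t / 2) / 8) hst
      continuous_h.continuousOn fun x hx => hasDerivAt_h (ht0.trans_lt hx.1)
    rw [eq_div_iff (sub_pos.2 hst).ne'] at hc'
    nlinarith [mono c s hc.2.le]

lemma h_sq (z : ℝ) : h (z ^ 2) = z / 2 - Real.log (1 + Real.exp z) := by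
  have e : 2 * Real.cosh (√(z ^ 2) / 2) = Real.exp (-(z / 2)) * (1 + Real.exp z) := by
    rw [Real.sqrt_sq_eq_abs, show |z| / 2 = |z / 2| by simp [abs_div], Real.cosh_abs,
      Real.cosh_eq, mul_add, ← Real.exp_add]
    ring_nf
  rw [h, e, Real.log_mul (Real.exp_pos _).ne' (by positivity), Real.log_exp]
  ring

/-- The constant term of the tangent tends to `-∞`: this makes the evidence coercive. -/
lemma gam_le {ξ : ℝ} (hξ : 0 ≤ ξ) : gam ξ ≤ -ξ / 4 := by
  have h1 : h (ξ ^ 2) ≤ -ξ / 2 := by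
    rw [h_sq]
    have : ξ ≤ Real.log (1 + Real.exp ξ) := by
      rw [Real.le_log_iff_exp_le (by positivity)]
      linarith
    linarith
  have h2 : -(ξ ^ 2 * A ξ) ≤ ξ / 4 := by
    rw [A_eq, abs_of_nonneg hξ]
    rcases hξ.eq_or_lt with rfl | h0
    · simp
    · rw [tanhc_of_ne (by positivity)]
      have := Real.tanh_lt_one (ξ / 2)
      have e : -(ξ ^ 2 * (-(Real.tanh (ξ / 2) / (ξ / 2)) / 8)) = ξ / 4 * Real.tanh (ξ / 2) := by
        field_simp
        ring
      rw [e]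
      nlinarith
  rw [gam]
  linarith

/-! ### The minorized likelihood kernel -/

/-- The Type II likelihood kernel `exp (a z) / (1 + exp z) ^ b`, written as an exponential. -/
noncomputable def kernel (M : CountModel n) (i : Fin n) (k : ℕ) (z : ℝ) : ℝ :=
  Real.exp (M.coefA i k * z - M.coefB i k * Real.log (1 + Real.exp z))

lemma kernel_pos (M : CountModel n) (i : Fin n) (k : ℕ) (z : ℝ) : 0 < kernel M i k z :=
  Real.exp_pos _

lemma minorizer_pos (M : CountModel n) (i : Fin n) (k : ℕ) (z ξ : ℝ) : 0 < minorizer M i k z ξ :=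
  Real.exp_pos _

lemma kernel_le_one {M : CountModel n} {i : Fin n} {k : ℕ} (ha : 0 ≤ M.coefA i k)
    (hab : M.coefA i k ≤ M.coefB i k) (z : ℝ) : kernel M i k z ≤ 1 := by
  rw [kernel, Real.exp_le_one_iff, sub_nonpos]
  have h0 : 0 ≤ Real.log (1 + Real.exp z) := Real.log_nonneg (by linarith [Real.exp_pos z])
  have h1 : z ≤ Real.log (1 + Real.exp z) := by
    rw [Real.le_log_iff_exp_le (by positivity)]
    linarith
  calc _ ≤ M.coefA i k * Real.log (1 + Real.exp z) := mul_le_mul_of_nonneg_left h1 ha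
    _ ≤ _ := mul_le_mul_of_nonneg_right hab h0

lemma minorizer_le_kernel {M : CountModel n} {i : Fin n} {k : ℕ} (hb : 0 ≤ M.coefB i k)
    (z ξ : ℝ) : minorizer M i k z ξ ≤ kernel M i k z := by
  rw [minorizer, kernel, Real.exp_le_exp]
  have := mul_le_mul_of_nonneg_left (A_mul_add_gam_le ξ z) hb
  rw [h_sq] at this
  linarith

lemma minorizer_le_exp {M : CountModel n} {i : Fin n} {k : ℕ} (hb : 0 ≤ M.coefB i k)
    (z : ℝ) {ξ : ℝ} (hξ : 0 ≤ ξ) :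
    minorizer M i k z ξ
      ≤ Real.exp ((M.coefA i k - M.coefB i k / 2) * z - M.coefB i k / 4 * ξ) := by
  rw [minorizer, Real.exp_le_exp]
  have h1 := mul_le_mul_of_nonneg_left (gam_le hξ) hb
  have h2 : M.coefB i k * A ξ * z ^ 2 ≤ 0 :=
    mul_nonpos_of_nonpos_of_nonneg (mul_nonpos_of_nonneg_of_nonpos hb (A_nonpos ξ)) (sq_nonneg z)
  linarith

/-- Tangency at `|z|` makes the minorizer exact at `z`, and the quadratic exponent is Lipschitz on
bounded sets, with a constant proportional to `b`. -/
lemma kernel_mul_exp_le_minorizer {M : CountModel n} {i : Fin n} {k : ℕ}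
    (ha : 0 ≤ M.coefA i k) (hab : M.coefA i k ≤ M.coefB i k) {z z' B δ : ℝ}
    (hB : |z| + |z'| ≤ B) (hδ : |z' - z| ≤ δ) :
    kernel M i k z * Real.exp (-((1 / 2 + B / 8) * δ * M.coefB i k))
      ≤ minorizer M i k z' |z| := by
  have hb := ha.trans hab
  rw [kernel, minorizer, ← Real.exp_add, Real.exp_le_exp, gam, sq_abs, h_sq]
  have h1 : -(M.coefB i k / 2 * δ) ≤ (M.coefA i k - M.coefB i k / 2) * (z' - z) := by
    refine (neg_le_neg ?_).trans (neg_abs_le _)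
    rw [abs_mul]
    exact mul_le_mul (abs_le.2 ⟨by linarith, by linarith⟩) hδ (abs_nonneg _) (by positivity)
  have h2 : -(M.coefB i k * (1 / 8 * (δ * B))) ≤ M.coefB i k * (A |z| * (z' ^ 2 - z ^ 2)) := by
    rw [← mul_neg]
    refine mul_le_mul_of_nonneg_left ((neg_le_neg ?_).trans (neg_abs_le _)) hb
    rw [abs_mul, show z' ^ 2 - z ^ 2 = (z' - z) * (z + z') by ring, abs_mul]
    refine mul_le_mul (abs_A_le _) (mul_le_mul hδ ((abs_add_le _ _).trans hB) (abs_nonneg _)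
      ((abs_nonneg _).trans hδ)) (by positivity) (by norm_num)
  nlinarith

end SSG

/-! ### The counting models -/

namespace SSG

open Filter Topology

variable {n p : ℕ}

lemma ringChoose_pos {m : ℝ} (hm : 0 < m) (k : ℕ) : 0 < Ring.choose (m + k - 1) k := by
  rw [← Ring.multichoose_eq]
  have h1 := Ring.factorial_nsmul_multichoose_eq_ascPochhammer m k
  rw [Polynomial.ascPochhammer_smeval_eq_eval, nsmul_eq_mul] at h1
  have h2 := ascPochhammer_pos k m hm
  rw [← h1] at h2
  exact pos_of_mul_pos_right h2 (Nat.cast_nonneg _)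

/-- The negative binomial series. -/
lemma hasSum_ringChoose_mul_pow (m : ℝ) {q : ℝ} (hq : |q| < 1) :
    HasSum (fun k : ℕ => Ring.choose (m + k - 1) k * q ^ k) ((1 - q) ^ m)⁻¹ := by
  have h1 := (Real.one_div_one_sub_rpow_hasFPowerSeriesOnBall_zero m).hasSum (y := q)
    (by simpa [enorm_eq_nnnorm, ← NNReal.coe_lt_coe] using hq)
  simpa [FormalMultilinearSeries.ofScalars_apply_eq, mul_comm] using h1

/-- The factor of the probability mass function that depends on the observation only. -/
noncomputable def CountModel.coef : CountModel n → Fin n → ℕ → ℝ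
  | .binomial m, i, k => ((m i).choose k : ℝ)
  | .negBinomial m, i, k => Ring.choose (m i + k - 1) k

lemma log_sigmoid (z : ℝ) : Real.log (Real.sigmoid z) = z - Real.log (1 + Real.exp z) := by
  have : Real.sigmoid z = Real.exp z / (1 + Real.exp z) := by
    rw [Real.sigmoid_def, Real.exp_neg]
    field_simp
    ring
  rw [this, Real.log_div (Real.exp_pos z).ne' (by positivity), Real.log_exp]

lemma log_one_sub_sigmoid (z : ℝ) :
    Real.log (1 - Real.sigmoid z) = -Real.log (1 + Real.exp z) := by
  rw [← Real.sigmoid_neg, Real.sigmoid_def, neg_neg, Real.log_inv]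

lemma one_sub_sigmoid_pos (z : ℝ) : 0 < 1 - Real.sigmoid z := sub_pos.2 (Real.sigmoid_lt_one z)

lemma pmf_eq (M : CountModel n) (i : Fin n) (z : ℝ) (k : ℕ) :
    M.pmf i z k = M.coef i k * kernel M i k z := by
  have h1 := Real.sigmoid_pos z
  have h2 := one_sub_sigmoid_pos z
  cases M with
  | binomial m =>
    simp only [CountModel.pmf, CountModel.coef, kernel, CountModel.coefA, CountModel.coefB]
    rcases le_or_gt k (m i) with hk | hk
    · rw [mul_assoc, ← Real.rpow_natCast, ← Real.rpow_natCast, Real.rpow_def_of_pos h1,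
        Real.rpow_def_of_pos h2, ← Real.exp_add, log_sigmoid, log_one_sub_sigmoid,
        Nat.cast_sub hk]
      ring_nf
    · simp [Nat.choose_eq_zero_of_lt hk]
  | negBinomial m =>
    simp only [CountModel.pmf, CountModel.coef, kernel, CountModel.coefA, CountModel.coefB]
    rw [mul_assoc, ← Real.rpow_natCast, Real.rpow_def_of_pos h1,
      Real.rpow_def_of_pos h2, ← Real.exp_add, log_sigmoid, log_one_sub_sigmoid]
    ring_nf

section

variable {M : CountModel n} {i : Fin n}

lemma coef_nonneg (hM : 0 < M.size i) (k : ℕ) : 0 ≤ M.coef i k := by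
  cases M with
  | binomial m => exact Nat.cast_nonneg _
  | negBinomial m => exact (ringChoose_pos hM k).le

lemma coef_zero (M : CountModel n) (i : Fin n) : M.coef i 0 = 1 := by
  cases M <;> simp [CountModel.coef]

lemma pmf_nonneg (hM : 0 < M.size i) (z : ℝ) (k : ℕ) : 0 ≤ M.pmf i z k := by
  rw [pmf_eq]
  exact mul_nonneg (coef_nonneg hM k) (kernel_pos M i k z).le

lemma coefA_nonneg (hM : 0 < M.size i) (k : ℕ) : 0 ≤ M.coefA i k := by
  cases M with
  | binomial m => exact Nat.cast_nonneg _
  | negBinomial m => exact le_of_lt hM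

lemma coefB_pos (hM : 0 < M.size i) (k : ℕ) : 0 < M.coefB i k := by
  cases M with
  | binomial m => exact hM
  | negBinomial m => exact add_pos_of_nonneg_of_pos (Nat.cast_nonneg k) hM

/-- For a Binomial count this says that possible observations do not exceed the size. -/
lemma coefA_le_coefB (k : ℕ) (hk : M.coef i k ≠ 0) : M.coefA i k ≤ M.coefB i k := by
  cases M with
  | binomial m =>
    simp only [CountModel.coef, CountModel.coefA, CountModel.coefB] at hk ⊢
    by_contra! hlt
    exact hk (by rw [Nat.choose_eq_zero_of_lt (by exact_mod_cast hlt), Nat.cast_zero])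
  | negBinomial m => exact le_add_of_nonneg_left (Nat.cast_nonneg k)

lemma hasSum_pmf (M : CountModel n) (i : Fin n) (z : ℝ) : HasSum (M.pmf i z) 1 := by
  have h1 := Real.sigmoid_pos z
  cases M with
  | binomial m =>
    have h2 : ∑ k ∈ Finset.range (m i + 1), (CountModel.binomial m).pmf i z k = 1 := by
      have := add_pow (Real.sigmoid z) (1 - Real.sigmoid z) (m i)
      rw [add_sub_cancel, one_pow] at this
      rw [this]
      refine Finset.sum_congr rfl fun k _ => ?_
      simp only [CountModel.pmf]
      ring
    rw [← h2]
    refine hasSum_sum_of_ne_finset_zero fun k hk => ?_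
    rw [Finset.mem_range, not_lt] at hk
    simp [CountModel.pmf, Nat.choose_eq_zero_of_lt (show m i < k by omega)]
  | negBinomial m =>
    have h2 := (hasSum_ringChoose_mul_pow (m i) (q := 1 - Real.sigmoid z)
      (abs_lt.2 ⟨by linarith [one_sub_sigmoid_pos z], by linarith⟩)).mul_left
        (Real.sigmoid z ^ m i)
    rw [sub_sub_cancel, mul_inv_cancel₀ (Real.rpow_pos_of_pos h1 _).ne'] at h2
    have e : (CountModel.negBinomial m).pmf i z = fun k : ℕ => Real.sigmoid z ^ m i *
        (Ring.choose (m i + k - 1) k * (1 - Real.sigmoid z) ^ k) := by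
      funext k
      simp only [CountModel.pmf]
      ring
    rw [e]
    exact h2

end

/-- The law of a single count. -/
noncomputable def obsLaw (M : CountModel n) (i : Fin n) (z : ℝ) : Measure ℕ :=
  Measure.count.withDensity fun k => ENNReal.ofReal (M.pmf i z k)

lemma obsLaw_singleton (M : CountModel n) (i : Fin n) (z : ℝ) (k : ℕ) :
    obsLaw M i z {k} = ENNReal.ofReal (M.pmf i z k) := by
  rw [obsLaw, withDensity_apply _ (measurableSet_singleton k)]
  simp

lemma isProbabilityMeasure_obsLaw {M : CountModel n} {i : Fin n} (hM : 0 < M.size i) (z : ℝ) :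
    IsProbabilityMeasure (obsLaw M i z) := by
  constructor
  rw [obsLaw, withDensity_apply _ MeasurableSet.univ, Measure.restrict_univ, lintegral_count,
    ← ENNReal.ofReal_tsum_of_nonneg (pmf_nonneg hM z) (hasSum_pmf M i z).summable,
    (hasSum_pmf M i z).tsum_eq, ENNReal.ofReal_one]

lemma dataLaw_eq (M : CountModel n) (X : Fin n → EuclideanSpace ℝ (Fin p))
    (β : EuclideanSpace ℝ (Fin p)) :
    dataLaw M X β = Measure.pi fun i => obsLaw M i (inner ℝ (X i) β) := rfl

lemma isProbabilityMeasure_dataLaw {M : CountModel n} (hM : ∀ i, 0 < M.size i)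
    (X : Fin n → EuclideanSpace ℝ (Fin p)) (β : EuclideanSpace ℝ (Fin p)) :
    IsProbabilityMeasure (dataLaw M X β) := by
  have := fun i => isProbabilityMeasure_obsLaw (hM i) (inner ℝ (X i) β)
  rw [dataLaw_eq]
  infer_instance

lemma dataLaw_singleton {M : CountModel n} (hM : ∀ i, 0 < M.size i)
    (X : Fin n → EuclideanSpace ℝ (Fin p)) (β : EuclideanSpace ℝ (Fin p)) (y : Fin n → ℕ) :
    dataLaw M X β {y} = ENNReal.ofReal (likelihood M X β y) := by
  have := fun i => isProbabilityMeasure_obsLaw (hM i) (inner ℝ (X i) β)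
  rw [dataLaw_eq, Measure.pi_singleton, likelihood,
    ENNReal.ofReal_prod_of_nonneg fun i _ => pmf_nonneg (hM i) _ _]
  exact Finset.prod_congr rfl fun i _ => obsLaw_singleton M i _ _

/-- The mean of the coefficient `b` is bounded when the size is bounded and the success probability
is bounded away from zero. For a Negative-Binomial count `k` with success probability `σ`, the
moment `E (1 + σ / 2) ^ k = (1 - σ / 2) ^ (-m) ≤ 2 ^ m` dominates `σ / 2 * E k`. -/
lemma lintegral_coefB_le {M : CountModel n} {i : Fin n} (hM : 0 < M.size i) {m_max : ℝ}
    (hm : M.size i ≤ m_max) {s z : ℝ} (hs : 0 < s) (hz : s ≤ Real.sigmoid z) :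
    ∫⁻ k, ENNReal.ofReal (M.coefB i k) ∂(obsLaw M i z)
      ≤ ENNReal.ofReal (2 ^ m_max * (2 / s) + m_max) := by
  have := isProbabilityMeasure_obsLaw hM z
  have hmm : 0 < m_max := hM.trans_le hm
  cases M with
  | binomial m =>
    simp only [CountModel.coefB, lintegral_const, measure_univ, mul_one]
    refine ENNReal.ofReal_le_ofReal (hm.trans (le_add_of_nonneg_left ?_))
    positivity
  | negBinomial m =>
    have hm0 : 0 < m i := hM
    set σ := Real.sigmoid z with hσ
    have hσ0 : 0 < σ := Real.sigmoid_pos z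
    have hσ1 : σ < 1 := Real.sigmoid_lt_one z
    have hq : |(1 - σ) * (1 + σ / 2)| < 1 := by
      rw [abs_of_nonneg (by nlinarith)]
      nlinarith
    have hsum := (hasSum_ringChoose_mul_pow (m i) hq).mul_left (σ ^ m i)
    have hval : σ ^ m i * ((1 - (1 - σ) * (1 + σ / 2)) ^ m i)⁻¹ ≤ 2 ^ m_max := by
      have e : 1 - (1 - σ) * (1 + σ / 2) = σ * ((1 + σ) / 2) := by ring
      rw [e, Real.mul_rpow hσ0.le (by linarith), mul_inv, ← mul_assoc,
        mul_inv_cancel₀ (Real.rpow_pos_of_pos hσ0 _).ne', one_mul,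
        ← Real.inv_rpow (by linarith)]
      refine (Real.rpow_le_rpow (by positivity) ?_ hm0.le).trans
        (Real.rpow_le_rpow_of_exponent_le one_le_two hm)
      rw [inv_le_comm₀ (by linarith) two_pos]
      linarith
    have hmean : ∫⁻ k, ENNReal.ofReal (k : ℝ) ∂(obsLaw (.negBinomial m) i z)
        ≤ ENNReal.ofReal (2 ^ m_max * (2 / s)) := by
      calc ∫⁻ k, ENNReal.ofReal (k : ℝ) ∂(obsLaw (.negBinomial m) i z)
          ≤ ∫⁻ k, ENNReal.ofReal (2 / s * (1 + σ / 2) ^ k) ∂(obsLaw (.negBinomial m) i z) := by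
            refine lintegral_mono fun k => ENNReal.ofReal_le_ofReal ?_
            have h1 := one_add_mul_le_pow (show -2 ≤ σ / 2 by linarith) k
            have h2 : (k : ℝ) = 2 / s * (k * (s / 2)) := by field_simp
            rw [h2]
            refine mul_le_mul_of_nonneg_left ?_ (by positivity)
            have h3 : (k : ℝ) * (s / 2) ≤ k * (σ / 2) :=
              mul_le_mul_of_nonneg_left (by linarith) (Nat.cast_nonneg k)
            linarith
        _ = ∑' k : ℕ, ENNReal.ofReal (2 / s * (σ ^ m i *
              (Ring.choose (m i + k - 1) k * ((1 - σ) * (1 + σ / 2)) ^ k))) := by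
            rw [lintegral_countable']
            refine tsum_congr fun k => ?_
            rw [obsLaw_singleton, ← ENNReal.ofReal_mul (by positivity)]
            congr 1
            simp only [CountModel.pmf, mul_pow]
            ring
        _ = ENNReal.ofReal (2 / s * (σ ^ m i * ((1 - (1 - σ) * (1 + σ / 2)) ^ m i)⁻¹)) := by
            have h1 := hsum.mul_left (2 / s)
            rw [← ENNReal.ofReal_tsum_of_nonneg (fun k => ?_) h1.summable, h1.tsum_eq]
            have := (ringChoose_pos hm0 k).le
            have : 0 ≤ 1 - σ := by linarith
            positivity
        _ ≤ _ := by
            refine ENNReal.ofReal_le_ofReal ?_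
            rw [mul_comm]
            exact mul_le_mul_of_nonneg_right hval (by positivity)
    simp only [CountModel.coefB]
    rw [ENNReal.ofReal_add (by positivity) hmm.le]
    calc _ = ∫⁻ k, (ENNReal.ofReal (k : ℝ) + ENNReal.ofReal (m i))
          ∂(obsLaw (.negBinomial m) i z) :=
          lintegral_congr fun k => ENNReal.ofReal_add (Nat.cast_nonneg k) hm0.le
      _ ≤ _ := by
          rw [lintegral_add_right _ measurable_const, lintegral_const, measure_univ, mul_one]
          exact add_le_add hmean (ENNReal.ofReal_le_ofReal hm)

lemma lintegral_sum_coefB_le {M : CountModel n} {X : Fin n → EuclideanSpace ℝ (Fin p)}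
    {β : EuclideanSpace ℝ (Fin p)} {m_max s : ℝ} (hM : ∀ i, 0 < M.size i ∧ M.size i ≤ m_max)
    (hs : 0 < s) (hX : ∀ i, s ≤ Real.sigmoid (inner ℝ (X i) β)) :
    ∫⁻ y, ENNReal.ofReal (∑ i, M.coefB i (y i)) ∂(dataLaw M X β)
      ≤ n * ENNReal.ofReal (2 ^ m_max * (2 / s) + m_max) := by
  have := fun i => isProbabilityMeasure_obsLaw (hM i).1 (inner ℝ (X i) β)
  calc _ = ∫⁻ y, ∑ i, ENNReal.ofReal (M.coefB i (y i)) ∂(dataLaw M X β) :=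
        lintegral_congr fun y =>
          ENNReal.ofReal_sum_of_nonneg fun i _ => (coefB_pos (hM i).1 (y i)).le
    _ = ∑ i, ∫⁻ y, ENNReal.ofReal (M.coefB i (y i)) ∂(dataLaw M X β) :=
        lintegral_finsetSum _ fun i _ => measurable_of_countable _
    _ = ∑ i, ∫⁻ k, ENNReal.ofReal (M.coefB i k) ∂(obsLaw M i (inner ℝ (X i) β)) := by
        refine Finset.sum_congr rfl fun i _ => ?_
        exact (measurePreserving_eval (fun i => obsLaw M i (inner ℝ (X i) β)) i).lintegral_comp
          (measurable_of_countable fun k => ENNReal.ofReal (M.coefB i k))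
    _ ≤ ∑ i : Fin n, ENNReal.ofReal (2 ^ m_max * (2 / s) + m_max) :=
        Finset.sum_le_sum fun i _ => lintegral_coefB_le (hM i).1 (hM i).2 hs (hX i)
    _ = _ := by simp

end SSG

/-! ### Small balls under a Gaussian prior -/

namespace SSG

open Filter Topology
open scoped MatrixOrder

variable {n p : ℕ}

lemma gaussianReal_ball_ge (a : ℝ) :
    ∃ κ : ℝ, 0 < κ ∧ ∀ r ∈ Ioc (0 : ℝ) 1,
      ENNReal.ofReal (κ * r) ≤ gaussianReal 0 1 (Metric.ball a r) := by
  set κ := gaussianPDFReal 0 1 (|a| + 1) with hκ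
  have hκ0 : 0 < κ := gaussianPDFReal_pos 0 1 _ one_ne_zero
  refine ⟨κ, hκ0, fun r hr => ?_⟩
  rw [gaussianReal_apply _ one_ne_zero]
  calc ENNReal.ofReal (κ * r) ≤ ENNReal.ofReal κ * volume (Metric.ball a r) := by
        rw [Real.volume_ball, ← ENNReal.ofReal_mul hκ0.le]
        refine ENNReal.ofReal_le_ofReal (mul_le_mul_of_nonneg_left ?_ hκ0.le)
        linarith [hr.1]
    _ = ∫⁻ _ in Metric.ball a r, ENNReal.ofReal κ := by rw [setLIntegral_const]
    _ ≤ ∫⁻ x in Metric.ball a r, gaussianPDF 0 1 x := by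
        refine setLIntegral_mono (measurable_gaussianPDF 0 1) fun x hx => ?_
        rw [gaussianPDF]
        refine ENNReal.ofReal_le_ofReal ?_
        have hx' : |x| ≤ |a| + 1 := by
          rw [Metric.mem_ball, Real.dist_eq] at hx
          have := abs_sub_abs_le_abs_sub x a
          linarith [hr.2]
        have hsq : x ^ 2 ≤ (|a| + 1) ^ 2 := by
          rw [← sq_abs x]
          exact pow_le_pow_left₀ (abs_nonneg x) hx' 2
        simp only [hκ, gaussianPDFReal, sub_zero, NNReal.coe_one, mul_one]
        gcongr

/-- A nondegenerate Gaussian measure on `ℝ ^ p` gives a ball of radius `r ≤ 1` mass of order at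
least `r ^ p`. -/
lemma multivariateGaussian_ball_ge (μ : EuclideanSpace ℝ (Fin p))
    {S : Matrix (Fin p) (Fin p) ℝ} (hS : S.PosDef) (β₀ : EuclideanSpace ℝ (Fin p)) :
    ∃ κ : ℝ, 0 < κ ∧ ∀ r ∈ Ioc (0 : ℝ) 1,
      (κ * r) ^ p ≤ (multivariateGaussian μ S).real (Metric.ball β₀ r) := by
  set T := Matrix.toEuclideanCLM (𝕜 := ℝ) (CFC.sqrt S) with hT
  -- the square root of `S` is invertible because its square is
  obtain ⟨x₀, hx₀⟩ : ∃ x, T x = β₀ - μ := by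
    have h1 : CFC.sqrt S * CFC.sqrt S = S := CFC.sqrt_mul_sqrt_self _ hS.posSemidef.nonneg
    have h2 : CFC.sqrt S * (CFC.sqrt S * S⁻¹) = 1 := by
      rw [← mul_assoc, h1, Matrix.mul_nonsing_inv _ ((Matrix.isUnit_iff_isUnit_det S).1 hS.isUnit)]
    refine ⟨Matrix.toEuclideanCLM (𝕜 := ℝ) (CFC.sqrt S * S⁻¹) (β₀ - μ), ?_⟩
    rw [hT, ← mul_apply_eq_comp, ← map_mul, h2, map_one]
    rfl
  set L : (Fin p → ℝ) →L[ℝ] EuclideanSpace ℝ (Fin p) :=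
    T.comp (EuclideanSpace.equiv (Fin p) ℝ).symm.toContinuousLinearMap with hL
  have hmap : multivariateGaussian μ S
      = (Measure.pi fun _ : Fin p => gaussianReal 0 1).map (fun x => μ + L x) := by
    rw [multivariateGaussian, ← map_pi_eq_stdGaussian, Measure.map_map (by fun_prop) (by fun_prop)]
    rfl
  set w : Fin p → ℝ := fun i => x₀ i with hw
  have hLw : μ + L w = β₀ := by
    have : L w = T x₀ := rfl
    rw [this, hx₀]; abel
  choose κ hκ0 hκ using gaussianReal_ball_ge
  obtain ⟨c, hc0, hc⟩ := Pi.exists_forall_pos_add_lt (x := fun _ : Fin p => (0 : ℝ))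
    (y := fun i => κ (w i)) fun i => hκ0 _
  set q := ‖L‖ + 1 with hq
  have hq0 : 1 ≤ q := by linarith [norm_nonneg L]
  refine ⟨c / q, by positivity, fun r hr => ?_⟩
  have hr' : r / q ∈ Ioc (0 : ℝ) 1 :=
    ⟨div_pos hr.1 (by positivity), div_le_one_of_le₀ (hr.2.trans hq0) (by positivity)⟩
  have hsub : Metric.ball w (r / q) ⊆ (fun x => μ + L x) ⁻¹' Metric.ball β₀ r := by
    intro x hx
    rw [mem_preimage, ← hLw, Metric.mem_ball, dist_add_left, dist_eq_norm, ← map_sub]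
    rw [Metric.mem_ball, dist_eq_norm, lt_div_iff₀ (by positivity)] at hx
    calc ‖L (x - w)‖ ≤ ‖L‖ * ‖x - w‖ := L.le_opNorm _
      _ ≤ ‖x - w‖ * q := by nlinarith [norm_nonneg (x - w)]
      _ < r := hx
  rw [measureReal_def, hmap, Measure.map_apply (by fun_prop) measurableSet_ball]
  refine (ENNReal.ofReal_le_iff_le_toReal (measure_ne_top _ _)).1 ?_
  refine le_trans ?_ (measure_mono hsub)
  rw [ball_pi _ hr'.1, Measure.pi_pi, ENNReal.ofReal_pow (by have := hr.1; positivity)]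
  calc ENNReal.ofReal (c / q * r) ^ p = ∏ i : Fin p, ENNReal.ofReal (c / q * r) := by simp
    _ ≤ _ := by
        refine Finset.prod_le_prod' fun i _ => le_trans (ENNReal.ofReal_le_ofReal ?_)
          (hκ (w i) (r / q) hr')
        rw [div_mul_eq_mul_div, ← mul_div_assoc]
        have := hc i
        have := hr.1
        gcongr
        linarith

end SSG

/-! ### Existence of an optimal variational parameter -/

namespace SSG

open Filter Topology

variable {n p : ℕ}

/-- The likelihood kernel of the whole sample. -/
noncomputable def kernelProd (M : CountModel n) (X : Fin n → EuclideanSpace ℝ (Fin p))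
    (β : EuclideanSpace ℝ (Fin p)) (y : Fin n → ℕ) : ℝ :=
  ∏ i, kernel M i (y i) (inner ℝ (X i) β)

section

variable {α : ℝ} {π : Measure (EuclideanSpace ℝ (Fin p))} {M : CountModel n}
  {X : Fin n → EuclideanSpace ℝ (Fin p)} {y : Fin n → ℕ}

lemma kernelProd_pos (β : EuclideanSpace ℝ (Fin p)) : 0 < kernelProd M X β y :=
  Finset.prod_pos fun i _ => kernel_pos M i _ _

lemma workingLikelihood_pos (ξ : Fin n → ℝ) (β : EuclideanSpace ℝ (Fin p)) :
    0 < workingLikelihood α M X y ξ β :=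
  Real.rpow_pos_of_pos (Finset.prod_pos fun i _ => minorizer_pos M i _ _ _) _

lemma workingLikelihood_le (hα : 0 ≤ α) (hb : ∀ i, 0 ≤ M.coefB i (y i)) (ξ : Fin n → ℝ)
    (β : EuclideanSpace ℝ (Fin p)) :
    workingLikelihood α M X y ξ β ≤ kernelProd M X β y ^ α :=
  Real.rpow_le_rpow (Finset.prod_nonneg fun i _ => (minorizer_pos M i _ _ _).le)
    (Finset.prod_le_prod (fun i _ => (minorizer_pos M i _ _ _).le)
      fun i _ => minorizer_le_kernel (hb i) _ _) hα

lemma workingLikelihood_le_one (hα : 0 ≤ α) (ha : ∀ i, 0 ≤ M.coefA i (y i))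
    (hab : ∀ i, M.coefA i (y i) ≤ M.coefB i (y i)) (ξ : Fin n → ℝ)
    (β : EuclideanSpace ℝ (Fin p)) : workingLikelihood α M X y ξ β ≤ 1 :=
  (workingLikelihood_le hα (fun i => (ha i).trans (hab i)) ξ β).trans <|
    Real.rpow_le_one (kernelProd_pos β).le
      (Finset.prod_le_one (fun i _ => (kernel_pos M i _ _).le)
        fun i _ => kernel_le_one (ha i) (hab i) _) hα

lemma continuous_workingLikelihood :
    Continuous fun q : (Fin n → ℝ) × EuclideanSpace ℝ (Fin p) =>
      workingLikelihood α M X y q.1 q.2 := by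
  have hA := continuous_A
  have hg := continuous_gam
  refine Continuous.rpow_const (continuous_finsetProd _ fun i _ => ?_) fun q =>
    Or.inl (Finset.prod_pos fun i _ => minorizer_pos M i _ _ _).ne'
  unfold minorizer
  fun_prop

lemma continuous_workingLikelihood_right (ξ : Fin n → ℝ) :
    Continuous (workingLikelihood α M X y ξ) :=
  (continuous_workingLikelihood (α := α) (M := M) (X := X) (y := y)).comp
    (f := fun β => (ξ, β)) (by fun_prop)

lemma continuous_workingLikelihood_left (β : EuclideanSpace ℝ (Fin p)) :
    Continuous fun ξ => workingLikelihood α M X y ξ β :=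
  (continuous_workingLikelihood (α := α) (M := M) (X := X) (y := y)).comp
    (f := fun ξ => (ξ, β)) (by fun_prop)

variable [IsProbabilityMeasure π]

lemma integrable_workingLikelihood (hα : 0 ≤ α) (ha : ∀ i, 0 ≤ M.coefA i (y i))
    (hab : ∀ i, M.coefA i (y i) ≤ M.coefB i (y i)) (ξ : Fin n → ℝ) :
    Integrable (workingLikelihood α M X y ξ) π := by
  refine Integrable.of_bound (C := 1)
    (continuous_workingLikelihood_right ξ).aestronglyMeasurable (ae_of_all _ fun β => ?_)
  rw [Real.norm_of_nonneg (workingLikelihood_pos ξ β).le]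
  exact workingLikelihood_le_one hα ha hab ξ β

lemma evidence_pos (hα : 0 ≤ α) (ha : ∀ i, 0 ≤ M.coefA i (y i))
    (hab : ∀ i, M.coefA i (y i) ≤ M.coefB i (y i)) (ξ : Fin n → ℝ) :
    0 < evidence α π M X y ξ := by
  rw [evidence, integral_pos_iff_support_of_nonneg (fun β => (workingLikelihood_pos ξ β).le)
    (integrable_workingLikelihood hα ha hab ξ)]
  rw [show Function.support (fun β => workingLikelihood α M X y ξ β) = univ from
    eq_univ_of_forall fun β => (workingLikelihood_pos ξ β).ne']
  simp

lemma continuous_evidence (hα : 0 ≤ α) (ha : ∀ i, 0 ≤ M.coefA i (y i))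
    (hab : ∀ i, M.coefA i (y i) ≤ M.coefB i (y i)) :
    Continuous (evidence α π M X y) := by
  refine continuous_of_dominated (bound := fun _ => 1)
    (fun ξ => (continuous_workingLikelihood_right ξ).aestronglyMeasurable)
    (fun ξ => ae_of_all _ fun β => ?_) (integrable_const _)
    (ae_of_all _ fun β => continuous_workingLikelihood_left β)
  rw [Real.norm_of_nonneg (workingLikelihood_pos ξ β).le]
  exact workingLikelihood_le_one hα ha hab ξ β

/-- The working likelihood decays exponentially in `‖ξ‖` for each `β`, and it is bounded by `1`;
hence the evidence vanishes at infinity. -/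
lemma tendsto_evidence (hα : 0 < α) (ha : ∀ i, 0 ≤ M.coefA i (y i))
    (hab : ∀ i, M.coefA i (y i) ≤ M.coefB i (y i)) (hb : ∀ i, 0 < M.coefB i (y i)) :
    Tendsto (evidence α π M X y) (cocompact (Fin n → ℝ) ⊓ 𝓟 {ξ | ∀ i, 0 ≤ ξ i}) (𝓝 0) := by
  obtain ⟨c, hc0, hc⟩ := Pi.exists_forall_pos_add_lt (x := fun _ : Fin n => (0 : ℝ))
    (y := fun i => M.coefB i (y i) / 4) fun i => by have := hb i; positivity
  rw [← Metric.cobounded_eq_cocompact, ← comap_norm_atTop]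
  have hlim : ∀ β, Tendsto (fun ξ => workingLikelihood α M X y ξ β)
      (comap norm atTop ⊓ 𝓟 {ξ : Fin n → ℝ | ∀ i, 0 ≤ ξ i}) (𝓝 0) := by
    intro β
    set s := ∑ i, (M.coefA i (y i) - M.coefB i (y i) / 2) * inner ℝ (X i) β with hs
    have hup : Tendsto (fun ξ : Fin n → ℝ => Real.exp (s - c * ‖ξ‖) ^ α)
        (comap norm atTop ⊓ 𝓟 {ξ : Fin n → ℝ | ∀ i, 0 ≤ ξ i}) (𝓝 0) := by
      have h1 : Tendsto (fun t : ℝ => s - c * t) atTop atBot :=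
        tendsto_atBot_add_const_left _ s
          (tendsto_neg_atTop_atBot.comp (tendsto_id.const_mul_atTop hc0))
      have h2 := (Real.tendsto_exp_atBot.comp h1).rpow_const (p := α) (Or.inr hα.le)
      rw [Real.zero_rpow hα.ne'] at h2
      exact h2.comp (tendsto_comap.mono_left inf_le_left)
    refine tendsto_of_tendsto_of_tendsto_of_le_of_le' tendsto_const_nhds hup
      (Eventually.of_forall fun ξ => (workingLikelihood_pos ξ β).le) ?_
    filter_upwards [mem_inf_of_right (mem_principal_self _)] with ξ hξ
    refine Real.rpow_le_rpow (Finset.prod_nonneg fun i _ => (minorizer_pos M i _ _ _).le)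
      ?_ hα.le
    have hterm : ∀ i, 0 ≤ M.coefB i (y i) / 4 * ξ i := fun i =>
      mul_nonneg (by have := hb i; positivity) (hξ i)
    have hnorm : c * ‖ξ‖ ≤ ∑ i, M.coefB i (y i) / 4 * ξ i := by
      rw [mul_comm, ← le_div_iff₀ hc0, pi_norm_le_iff_of_nonneg
        (div_nonneg (Finset.sum_nonneg fun i _ => hterm i) hc0.le)]
      intro j
      rw [Real.norm_of_nonneg (hξ j), le_div_iff₀ hc0, mul_comm]
      refine le_trans ?_ (Finset.single_le_sum (fun i _ => hterm i) (Finset.mem_univ j))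
      exact mul_le_mul_of_nonneg_right (by have := hc j; linarith) (hξ j)
    calc ∏ i, minorizer M i (y i) (inner ℝ (X i) β) (ξ i)
        ≤ ∏ i, Real.exp ((M.coefA i (y i) - M.coefB i (y i) / 2) * inner ℝ (X i) β
            - M.coefB i (y i) / 4 * ξ i) :=
          Finset.prod_le_prod (fun i _ => (minorizer_pos M i _ _ _).le)
            fun i _ => minorizer_le_exp (hb i).le _ (hξ i)
      _ ≤ Real.exp (s - c * ‖ξ‖) := by
          rw [← Real.exp_sum, Real.exp_le_exp, Finset.sum_sub_distrib]
          linarith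
  have h := tendsto_integral_filter_of_dominated_convergence (μ := π) (fun _ => (1 : ℝ))
    (Eventually.of_forall fun ξ =>
      (continuous_workingLikelihood_right (α := α) (M := M) (X := X) (y := y)
        ξ).aestronglyMeasurable)
    (Eventually.of_forall fun ξ => ae_of_all _ fun β => by
      rw [Real.norm_of_nonneg (workingLikelihood_pos ξ β).le]
      exact workingLikelihood_le_one hα.le ha hab ξ β) (integrable_const _)
    (ae_of_all _ hlim)
  simp only [integral_zero] at h
  exact h

lemma exists_isOptimal (hα : 0 < α) (ha : ∀ i, 0 ≤ M.coefA i (y i))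
    (hab : ∀ i, M.coefA i (y i) ≤ M.coefB i (y i)) (hb : ∀ i, 0 < M.coefB i (y i)) :
    ∃ ξ, IsOptimal α π M X y ξ := by
  have hclosed : IsClosed {ξ : Fin n → ℝ | ∀ i, 0 ≤ ξ i} := by
    simp only [ofPred_forall]
    exact isClosed_iInter fun i => isClosed_le continuous_const (continuous_apply i)
  obtain ⟨ξ, hξ, hmax⟩ := ContinuousOn.exists_isMaxOn'
    (continuous_evidence (π := π) (X := X) hα.le ha hab).continuousOn hclosed
    (x₀ := 0) (fun _ => le_rfl)
    ((tendsto_evidence hα ha hab hb).eventually_le_const (evidence_pos hα.le ha hab 0))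
  exact ⟨ξ, hξ, fun ξ' hξ' => Real.log_le_log (evidence_pos hα.le ha hab ξ') (hmax hξ')⟩

lemma IsOptimal.evidence_le {ξ ξ' : Fin n → ℝ} (h : IsOptimal α π M X y ξ) (hα : 0 ≤ α)
    (ha : ∀ i, 0 ≤ M.coefA i (y i)) (hab : ∀ i, M.coefA i (y i) ≤ M.coefB i (y i))
    (hξ' : ∀ i, 0 ≤ ξ' i) : evidence α π M X y ξ' ≤ evidence α π M X y ξ :=
  (Real.log_le_log_iff (evidence_pos hα ha hab ξ') (evidence_pos hα ha hab ξ)).1 (h.2 hξ')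

end

end SSG

/-! ### The Rényi divergence and its exponential moment identity -/

namespace SSG

open Filter Topology

variable {n p : ℕ} {α : ℝ} {M : CountModel n} {X : Fin n → EuclideanSpace ℝ (Fin p)}

/-- The Hellinger-type affinity `∑ y, p(y ∣ X, β) ^ α p(y ∣ X, β₀) ^ (1 - α)`. -/
noncomputable def affinity (α : ℝ) (M : CountModel n) (X : Fin n → EuclideanSpace ℝ (Fin p))
    (β β₀ : EuclideanSpace ℝ (Fin p)) : ℝ :=
  ∑' y : Fin n → ℕ, likelihood M X β y ^ α * likelihood M X β₀ y ^ (1 - α)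

lemma likelihood_nonneg (hM : ∀ i, 0 < M.size i) (β : EuclideanSpace ℝ (Fin p))
    (y : Fin n → ℕ) : 0 ≤ likelihood M X β y :=
  Finset.prod_nonneg fun i _ => pmf_nonneg (hM i) _ _

lemma likelihood_eq (β : EuclideanSpace ℝ (Fin p)) (y : Fin n → ℕ) :
    likelihood M X β y = (∏ i, M.coef i (y i)) * kernelProd M X β y := by
  rw [likelihood, kernelProd, ← Finset.prod_mul_distrib]
  exact Finset.prod_congr rfl fun i _ => pmf_eq M i _ _

lemma continuous_kernelProd (y : Fin n → ℕ) :
    Continuous fun β => kernelProd M X β y := by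
  refine continuous_finsetProd _ fun i _ => ?_
  unfold kernel
  have : Continuous fun β => Real.log (1 + Real.exp (inner ℝ (X i) β)) :=
    Continuous.log (by fun_prop) fun β => by positivity
  fun_prop

lemma continuous_likelihood (y : Fin n → ℕ) :
    Continuous fun β => likelihood M X β y := by
  simp only [likelihood_eq]
  exact continuous_const.mul (continuous_kernelProd y)

lemma hasSum_likelihood (hM : ∀ i, 0 < M.size i) (β : EuclideanSpace ℝ (Fin p)) :
    HasSum (likelihood M X β) 1 := by
  have := isProbabilityMeasure_dataLaw hM X β
  have h1 : ∑' y, ENNReal.ofReal (likelihood M X β y) = 1 := by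
    have h2 := lintegral_countable' (μ := dataLaw M X β) (fun _ => 1)
    simp only [lintegral_const, measure_univ, one_mul, dataLaw_singleton hM] at h2
    exact h2.symm
  have h3 := ENNReal.hasSum_toReal (f := fun y => ENNReal.ofReal (likelihood M X β y))
    (by rw [h1]; exact ENNReal.one_ne_top)
  have h4 := congrArg ENNReal.toReal h1
  rw [ENNReal.tsum_toReal_eq fun _ => ENNReal.ofReal_ne_top] at h4
  simp only [ENNReal.toReal_ofReal (likelihood_nonneg hM β _), ENNReal.toReal_one] at h3 h4
  rwa [h4] at h3

lemma affinity_term_nonneg (hM : ∀ i, 0 < M.size i)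
    (β β₀ : EuclideanSpace ℝ (Fin p)) (y : Fin n → ℕ) :
    0 ≤ likelihood M X β y ^ α * likelihood M X β₀ y ^ (1 - α) :=
  mul_nonneg (Real.rpow_nonneg (likelihood_nonneg hM β y) _)
    (Real.rpow_nonneg (likelihood_nonneg hM β₀ y) _)

lemma affinity_term_le (hM : ∀ i, 0 < M.size i) (hα : α ∈ Ioo (0 : ℝ) 1)
    (β β₀ : EuclideanSpace ℝ (Fin p)) (y : Fin n → ℕ) :
    likelihood M X β y ^ α * likelihood M X β₀ y ^ (1 - α)
      ≤ α * likelihood M X β y + (1 - α) * likelihood M X β₀ y :=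
  Real.geom_mean_le_arith_mean2_weighted hα.1.le (sub_pos.2 hα.2).le
    (likelihood_nonneg hM β y) (likelihood_nonneg hM β₀ y) (by ring)

lemma hasSum_affinity_bound (hM : ∀ i, 0 < M.size i)
    (β β₀ : EuclideanSpace ℝ (Fin p)) :
    HasSum (fun y => α * likelihood M X β y + (1 - α) * likelihood M X β₀ y) 1 := by
  have := ((hasSum_likelihood (X := X) hM β).mul_left α).add
    ((hasSum_likelihood (X := X) hM β₀).mul_left (1 - α))
  simpa using this

lemma summable_affinity (hM : ∀ i, 0 < M.size i) (hα : α ∈ Ioo (0 : ℝ) 1)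
    (β β₀ : EuclideanSpace ℝ (Fin p)) :
    Summable fun y => likelihood M X β y ^ α * likelihood M X β₀ y ^ (1 - α) :=
  Summable.of_nonneg_of_le (affinity_term_nonneg hM β β₀) (affinity_term_le hM hα β β₀)
    (hasSum_affinity_bound hM β β₀).summable

lemma affinity_le_one (hM : ∀ i, 0 < M.size i) (hα : α ∈ Ioo (0 : ℝ) 1)
    (β β₀ : EuclideanSpace ℝ (Fin p)) : affinity α M X β β₀ ≤ 1 :=
  (Summable.tsum_le_tsum (affinity_term_le hM hα β β₀) (summable_affinity hM hα β β₀)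
    (hasSum_affinity_bound hM β β₀).summable).trans_eq
    (hasSum_affinity_bound hM β β₀).tsum_eq

/-- The affinity never vanishes, since the zero observation is always possible. -/
lemma affinity_pos (hM : ∀ i, 0 < M.size i) (hα : α ∈ Ioo (0 : ℝ) 1)
    (β β₀ : EuclideanSpace ℝ (Fin p)) : 0 < affinity α M X β β₀ := by
  have h0 : ∀ β', 0 < likelihood M X β' 0 := fun β' => by
    rw [likelihood_eq]
    simp only [Pi.zero_apply, coef_zero, Finset.prod_const_one, one_mul]
    exact kernelProd_pos β'
  exact (summable_affinity hM hα β β₀).tsum_pos (affinity_term_nonneg hM β β₀) 0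
    (mul_pos (Real.rpow_pos_of_pos (h0 β) _) (Real.rpow_pos_of_pos (h0 β₀) _))

lemma measurable_affinity (β₀ : EuclideanSpace ℝ (Fin p)) :
    Measurable fun β => affinity α M X β β₀ := by
  unfold affinity
  exact Measurable.tsum fun y => ((continuous_likelihood y).measurable.pow_const α).mul_const _

/-- The likelihood ratio raised to the power `α` has mean `affinity α M X β β₀` under the law of
the data with parameter `β₀`. -/
lemma tsum_kernelProd_ratio (hM : ∀ i, 0 < M.size i) (hα : α ∈ Ioo (0 : ℝ) 1)
    (β β₀ : EuclideanSpace ℝ (Fin p)) :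
    ∑' y, ENNReal.ofReal ((kernelProd M X β y / kernelProd M X β₀ y) ^ α) * dataLaw M X β₀ {y}
      = ENNReal.ofReal (affinity α M X β β₀) := by
  rw [affinity, ENNReal.ofReal_tsum_of_nonneg (affinity_term_nonneg hM β β₀)
    (summable_affinity hM hα β β₀)]
  refine tsum_congr fun y => ?_
  have hk := kernelProd_pos (M := M) (X := X) (y := y) β
  have hk₀ := kernelProd_pos (M := M) (X := X) (y := y) β₀
  rw [dataLaw_singleton hM, ← ENNReal.ofReal_mul (by positivity)]
  congr 1
  have hc : 0 ≤ ∏ i, M.coef i (y i) := Finset.prod_nonneg fun i _ => coef_nonneg (hM i) _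
  rw [likelihood_eq, likelihood_eq]
  rcases hc.eq_or_lt with hc | hc
  · rw [← hc, zero_mul, zero_mul, mul_zero, Real.zero_rpow hα.1.ne', zero_mul]
  · rw [Real.div_rpow hk.le hk₀.le, Real.mul_rpow hc.le hk.le, Real.mul_rpow hc.le hk₀.le,
      Real.rpow_sub hc, Real.rpow_sub hk₀, Real.rpow_one, Real.rpow_one]
    have := Real.rpow_pos_of_pos hc α
    have := Real.rpow_pos_of_pos hk₀ α
    field_simp

/-- Averaging over the prior: the expectation of
`∫ exp ((1 - α) n D_α(β, β₀)) (p(y ∣ X, β) / p(y ∣ X, β₀)) ^ α π(dβ)` is one. -/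
lemma lintegral_exp_renyi (hM : ∀ i, 0 < M.size i) (hα : α ∈ Ioo (0 : ℝ) 1)
    (π : Measure (EuclideanSpace ℝ (Fin p))) [IsProbabilityMeasure π]
    (β₀ : EuclideanSpace ℝ (Fin p)) :
    ∫⁻ y, ∫⁻ β, ENNReal.ofReal ((affinity α M X β β₀)⁻¹ *
      (kernelProd M X β y / kernelProd M X β₀ y) ^ α) ∂π ∂(dataLaw M X β₀) = 1 := by
  have hmeas : ∀ y, Measurable fun β => ENNReal.ofReal ((affinity α M X β β₀)⁻¹ *
      (kernelProd M X β y / kernelProd M X β₀ y) ^ α) := fun y =>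
    ((measurable_affinity β₀).inv.mul
      (((continuous_kernelProd y).measurable.div_const _).pow_const α)).ennreal_ofReal
  rw [lintegral_countable']
  simp_rw [← lintegral_mul_const _ (hmeas _)]
  rw [← lintegral_tsum fun y => ((hmeas y).mul_const _).aemeasurable]
  have key : ∀ β, ∑' y, ENNReal.ofReal ((affinity α M X β β₀)⁻¹ *
      (kernelProd M X β y / kernelProd M X β₀ y) ^ α) * dataLaw M X β₀ {y} = 1 := by
    intro β
    have h0 := affinity_pos (X := X) hM hα β β₀
    simp_rw [ENNReal.ofReal_mul (inv_nonneg.2 h0.le), mul_assoc]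
    rw [ENNReal.tsum_mul_left, tsum_kernelProd_ratio hM hα, ← ENNReal.ofReal_mul
      (inv_nonneg.2 h0.le), inv_mul_cancel₀ h0.ne', ENNReal.ofReal_one]
  simp_rw [key]
  simp

lemma renyiDiv_eq (β β₀ : EuclideanSpace ℝ (Fin p)) :
    renyiDiv α M X β β₀ = 1 / (n * (α - 1)) * Real.log (affinity α M X β β₀) := rfl

/-! ### The deterministic posterior bound -/

/-- Jensen's inequality for the exponential, in a form that also yields integrability. -/
lemma integral_le_log_of_lintegral_exp_le {Ω : Type*} [MeasurableSpace Ω] {ρ : Measure Ω}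
    [IsProbabilityMeasure ρ] {f : Ω → ℝ} (hf : Measurable f) (hf0 : ∀ x, 0 ≤ f x) {c : ℝ}
    (hc : 0 < c) (h : ∫⁻ x, ENNReal.ofReal (Real.exp (f x)) ∂ρ ≤ ENNReal.ofReal c) :
    Integrable f ρ ∧ ∫ x, f x ∂ρ ≤ Real.log c := by
  have hexp : Integrable (fun x => Real.exp (f x)) ρ := by
    refine ⟨hf.exp.aestronglyMeasurable, ?_⟩
    rw [hasFiniteIntegral_iff_ofReal (ae_of_all _ fun x => (Real.exp_pos _).le)]
    exact h.trans_lt ENNReal.ofReal_lt_top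
  have hint : ∫ x, Real.exp (f x) ∂ρ ≤ c := by
    rw [integral_eq_lintegral_of_nonneg_ae (ae_of_all _ fun x => (Real.exp_pos _).le)
      hf.exp.aestronglyMeasurable]
    exact ENNReal.toReal_le_of_le_ofReal hc.le h
  have hfi : Integrable f ρ := by
    refine hexp.mono' hf.aestronglyMeasurable (ae_of_all _ fun x => ?_)
    rw [Real.norm_of_nonneg (hf0 x)]
    linarith [Real.add_one_le_exp (f x)]
  refine ⟨hfi, ?_⟩
  -- the tangent line of the exponential at `log c`
  have hpt : ∀ x, f x ≤ Real.exp (f x) / c + (Real.log c - 1) := fun x => by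
    have := Real.add_one_le_exp (f x - Real.log c)
    rw [Real.exp_sub, Real.exp_log hc] at this
    linarith
  calc ∫ x, f x ∂ρ ≤ ∫ x, (Real.exp (f x) / c + (Real.log c - 1)) ∂ρ :=
        integral_mono hfi ((hexp.div_const c).add (integrable_const _)) hpt
    _ = (∫ x, Real.exp (f x) ∂ρ) / c + (Real.log c - 1) := by
        rw [integral_add (hexp.div_const c) (integrable_const _), integral_div]
        simp
    _ ≤ Real.log c := by
        have : (∫ x, Real.exp (f x) ∂ρ) / c ≤ 1 := div_le_one_of_le₀ hint hc.le
        linarith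

section

variable {π : Measure (EuclideanSpace ℝ (Fin p))} [IsProbabilityMeasure π] {y : Fin n → ℕ}
  {β₀ : EuclideanSpace ℝ (Fin p)}

/-- Lower bound for the evidence at the variational parameter that makes the minorizer exact
at `β₀`. -/
lemma le_evidence (hα : 0 ≤ α) (ha : ∀ i, 0 ≤ M.coefA i (y i))
    (hab : ∀ i, M.coefA i (y i) ≤ M.coefB i (y i)) {R r : ℝ} (hR : 0 ≤ R)
    (hX : ∀ i, ‖X i‖ ≤ R) (hr : r ≤ 1) :
    π.real (Metric.ball β₀ r) * (kernelProd M X β₀ y ^ α *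
        Real.exp (-(α * ((1 / 2 + (2 * R * ‖β₀‖ + R) / 8) * (R * r) * ∑ i, M.coefB i (y i)))))
      ≤ evidence α π M X y fun i => |inner ℝ (X i) β₀| := by
  set ξ : Fin n → ℝ := fun i => |inner ℝ (X i) β₀| with hξ
  set K := (1 / 2 + (2 * R * ‖β₀‖ + R) / 8) * (R * r) with hK
  have hint := integrable_workingLikelihood (π := π) (X := X) hα ha hab ξ
  have hpt : ∀ β ∈ Metric.ball β₀ r, kernelProd M X β₀ y ^ α *
      Real.exp (-(α * (K * ∑ i, M.coefB i (y i)))) ≤ workingLikelihood α M X y ξ β := by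
    intro β hβ
    rw [Metric.mem_ball, dist_eq_norm] at hβ
    have hin : ∀ (i : Fin n) (v : EuclideanSpace ℝ (Fin p)), |inner ℝ (X i) v| ≤ R * ‖v‖ :=
      fun i v => (abs_real_inner_le_norm _ _).trans
        (mul_le_mul_of_nonneg_right (hX i) (norm_nonneg v))
    have hβn : ‖β‖ ≤ ‖β₀‖ + 1 := by
      have := norm_le_norm_add_norm_sub' β β₀
      linarith
    have hfac : ∀ i, kernel M i (y i) (inner ℝ (X i) β₀) * Real.exp (-(K * M.coefB i (y i)))
        ≤ minorizer M i (y i) (inner ℝ (X i) β) (ξ i) := fun i => by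
      refine kernel_mul_exp_le_minorizer (ha i) (hab i) ?_ ?_
      · have h1 := hin i β₀
        have h2 := (hin i β).trans (mul_le_mul_of_nonneg_left hβn hR)
        linarith
      · rw [← inner_sub_right]
        exact (hin i _).trans (mul_le_mul_of_nonneg_left hβ.le hR)
    have hexp : Real.exp (-(α * (K * ∑ i, M.coefB i (y i))))
        = (∏ i, Real.exp (-(K * M.coefB i (y i)))) ^ α := by
      rw [← Real.exp_sum, ← Real.exp_mul, Finset.sum_neg_distrib, ← Finset.mul_sum]
      ring_nf
    rw [hexp, kernelProd, ← Real.mul_rpow (Finset.prod_nonneg fun i _ => (kernel_pos M i _ _).le)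
      (Finset.prod_nonneg fun i _ => (Real.exp_pos _).le), ← Finset.prod_mul_distrib]
    exact Real.rpow_le_rpow
      (Finset.prod_nonneg fun i _ => (mul_pos (kernel_pos M i _ _) (Real.exp_pos _)).le)
      (Finset.prod_le_prod (fun i _ => (mul_pos (kernel_pos M i _ _) (Real.exp_pos _)).le)
        fun i _ => hfac i) hα
  calc _ = ∫ _ in Metric.ball β₀ r, kernelProd M X β₀ y ^ α *
        Real.exp (-(α * (K * ∑ i, M.coefB i (y i)))) ∂π := by
        rw [setIntegral_const, smul_eq_mul]
    _ ≤ ∫ β in Metric.ball β₀ r, workingLikelihood α M X y ξ β ∂π :=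
        setIntegral_mono_on (integrableOn_const (measure_ne_top _ _)) hint.integrableOn
          measurableSet_ball hpt
    _ ≤ ∫ β, workingLikelihood α M X y ξ β ∂π :=
        setIntegral_le_integral hint (ae_of_all _ fun β => (workingLikelihood_pos ξ β).le)

lemma isProbabilityMeasure_posterior (hα : 0 ≤ α) (ha : ∀ i, 0 ≤ M.coefA i (y i))
    (hab : ∀ i, M.coefA i (y i) ≤ M.coefB i (y i)) (ξ : Fin n → ℝ) :
    IsProbabilityMeasure (posterior α π M X y ξ) := by
  constructor
  have hZ := evidence_pos (π := π) (X := X) hα ha hab ξ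
  rw [posterior, withDensity_apply _ MeasurableSet.univ, Measure.restrict_univ,
    ← ofReal_integral_eq_lintegral_ofReal
      ((integrable_workingLikelihood hα ha hab ξ).div_const _)
      (ae_of_all _ fun β => (div_pos (workingLikelihood_pos ξ β) hZ).le), integral_div]
  change ENNReal.ofReal (evidence α π M X y ξ / evidence α π M X y ξ) = 1
  rw [div_self hZ.ne', ENNReal.ofReal_one]

/-- On the event that the averaged exponential moment is at most `E` and the total of the
coefficients `b` is under control, the posterior risk is bounded by the prior mass of a small
ball. -/
lemma posterior_risk_le (hn : 0 < n) (hM : ∀ i, 0 < M.size i) (hα : α ∈ Ioo (0 : ℝ) 1)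
    (hab : ∀ i, M.coefA i (y i) ≤ M.coefB i (y i)) {R r : ℝ} (hR : 0 ≤ R)
    (hX : ∀ i, ‖X i‖ ≤ R) (hr : r ≤ 1) (hball : 0 < π.real (Metric.ball β₀ r)) {E W : ℝ}
    (hE0 : 0 < E)
    (hE : ∫⁻ β, ENNReal.ofReal ((affinity α M X β β₀)⁻¹ *
      (kernelProd M X β y / kernelProd M X β₀ y) ^ α) ∂π ≤ ENNReal.ofReal E)
    (hW : (1 / 2 + (2 * R * ‖β₀‖ + R) / 8) * (R * r) * ∑ i, M.coefB i (y i) ≤ W)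
    {ξ : Fin n → ℝ} (hξ : IsOptimal α π M X y ξ) :
    Integrable (fun β => renyiDiv α M X β β₀) (posterior α π M X y ξ) ∧
      (1 - α) * ∫ β, renyiDiv α M X β β₀ ∂(posterior α π M X y ξ)
        ≤ (Real.log E + α * W - Real.log (π.real (Metric.ball β₀ r))) / n := by
  have ha : ∀ i, 0 ≤ M.coefA i (y i) := fun i => coefA_nonneg (hM i) _
  have hb : ∀ i, 0 ≤ M.coefB i (y i) := fun i => (ha i).trans (hab i)
  have hα0 := hα.1.le
  have hα1 : 0 < 1 - α := sub_pos.2 hα.2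
  have hn' : (0 : ℝ) < n := Nat.cast_pos.2 hn
  have := isProbabilityMeasure_posterior (π := π) (X := X) hα0 ha hab ξ
  set Z := evidence α π M X y ξ with hZdef
  have hZ : 0 < Z := evidence_pos hα0 ha hab ξ
  set G₀ := kernelProd M X β₀ y with hG₀
  have hG₀pos : 0 < G₀ := kernelProd_pos β₀
  set B := π.real (Metric.ball β₀ r) with hB
  have hZlow : B * (G₀ ^ α * Real.exp (-(α * W))) ≤ Z := by
    refine le_trans ?_ ((le_evidence (π := π) (β₀ := β₀) hα0 ha hab hR hX hr).trans
      (hξ.evidence_le hα0 ha hab fun i => abs_nonneg _))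
    gcongr
  have hratio : G₀ ^ α / Z ≤ Real.exp (α * W) / B := by
    rw [Real.exp_neg] at hZlow
    rw [div_le_div_iff₀ hZ hball]
    have := Real.exp_pos (α * W)
    calc G₀ ^ α * B = B * (G₀ ^ α * (Real.exp (α * W))⁻¹) * Real.exp (α * W) := by
          field_simp
      _ ≤ Z * Real.exp (α * W) := mul_le_mul_of_nonneg_right hZlow this.le
      _ = _ := mul_comm _ _
  have hmaff := measurable_affinity (α := α) (M := M) (X := X) β₀
  set Φ : EuclideanSpace ℝ (Fin p) → ℝ := fun β => -Real.log (affinity α M X β β₀) with hΦ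
  have hmΦ : Measurable Φ := hmaff.log.neg
  have hΦexp : ∀ β, Real.exp (Φ β) = (affinity α M X β β₀)⁻¹ := fun β => by
    rw [hΦ, Real.exp_neg, Real.exp_log (affinity_pos hM hα β β₀)]
  have hmoment : ∫⁻ β, ENNReal.ofReal (Real.exp (Φ β)) ∂(posterior α π M X y ξ)
      ≤ ENNReal.ofReal (Real.exp (α * W) / B * E) := by
    have hmw : Measurable (workingLikelihood α M X y ξ) :=
      (continuous_workingLikelihood_right ξ).measurable
    rw [posterior, lintegral_withDensity_eq_lintegral_mul _
      (hmw.div_const _).ennreal_ofReal hmΦ.exp.ennreal_ofReal]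
    calc _ ≤ ∫⁻ β, ENNReal.ofReal (G₀ ^ α / Z) * ENNReal.ofReal ((affinity α M X β β₀)⁻¹ *
          (kernelProd M X β y / G₀) ^ α) ∂π := by
          refine lintegral_mono fun β => ?_
          have hA0 := affinity_pos (X := X) hM hα β β₀
          have hw := workingLikelihood_le (X := X) hα0 hb ξ β
          have hk := kernelProd_pos (M := M) (X := X) (y := y) β
          rw [Pi.mul_apply, ← ENNReal.ofReal_mul (div_pos (workingLikelihood_pos ξ β) hZ).le,
            ← ENNReal.ofReal_mul (by positivity), hΦexp]
          refine ENNReal.ofReal_le_ofReal ?_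
          rw [Real.div_rpow hk.le hG₀pos.le]
          have e : G₀ ^ α / Z * ((affinity α M X β β₀)⁻¹ * (kernelProd M X β y ^ α / G₀ ^ α))
              = kernelProd M X β y ^ α / Z * (affinity α M X β β₀)⁻¹ := by
            have := Real.rpow_pos_of_pos hG₀pos α
            field_simp
          rw [e]
          gcongr
      _ ≤ ENNReal.ofReal (G₀ ^ α / Z) * ENNReal.ofReal E := by
          rw [lintegral_const_mul' _ _ ENNReal.ofReal_ne_top]
          gcongr
      _ ≤ _ := by
          rw [← ENNReal.ofReal_mul (by positivity)]
          exact ENNReal.ofReal_le_ofReal (mul_le_mul_of_nonneg_right hratio hE0.le)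
  obtain ⟨hΦi, hΦle⟩ := integral_le_log_of_lintegral_exp_le hmΦ
    (fun β => neg_nonneg.2 (Real.log_nonpos (affinity_pos hM hα β β₀).le
      (affinity_le_one hM hα β β₀))) (by positivity) hmoment
  have hD : (fun β => renyiDiv α M X β β₀) = fun β => 1 / (n * (1 - α)) * Φ β := by
    funext β
    rw [renyiDiv_eq, hΦ]
    have : α - 1 ≠ 0 := by linarith
    have : 1 - α ≠ 0 := hα1.ne'
    field_simp
    ring
  rw [hD]
  refine ⟨hΦi.const_mul _, ?_⟩
  rw [integral_const_mul]
  have e : (1 - α) * (1 / (n * (1 - α)) * ∫ β, Φ β ∂(posterior α π M X y ξ))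
      = (∫ β, Φ β ∂(posterior α π M X y ξ)) / n := by
    field_simp
  rw [Real.log_mul (by positivity) hE0.ne', Real.log_div (Real.exp_pos _).ne' hball.ne',
    Real.log_exp] at hΦle
  rw [e]
  gcongr
  linarith

end

end SSG

/-! ### The probability of the good event -/

namespace SSG

variable {n p : ℕ} {α : ℝ} {M : CountModel n} {X : Fin n → EuclideanSpace ℝ (Fin p)}

lemma dataLaw_impossible (hM : ∀ i, 0 < M.size i) (β₀ : EuclideanSpace ℝ (Fin p)) :
    dataLaw M X β₀ {y | ∃ i, M.coef i (y i) = 0} = 0 := by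
  refine (measure_null_iff_singleton (to_countable _)).2 ?_
  rintro y ⟨i, hi⟩
  rw [dataLaw_singleton hM, likelihood_eq, Finset.prod_eq_zero (Finset.mem_univ i) hi, zero_mul,
    ENNReal.ofReal_zero]

lemma dataLaw_large_moment_le (hM : ∀ i, 0 < M.size i) (hα : α ∈ Ioo (0 : ℝ) 1)
    (π : Measure (EuclideanSpace ℝ (Fin p))) [IsProbabilityMeasure π]
    (β₀ : EuclideanSpace ℝ (Fin p)) {ε : ℝ} (hε : 0 < ε) :
    dataLaw M X β₀ {y | ENNReal.ofReal (1 / ε) ≤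
        ∫⁻ β, ENNReal.ofReal ((affinity α M X β β₀)⁻¹ *
          (kernelProd M X β y / kernelProd M X β₀ y) ^ α) ∂π} ≤ ENNReal.ofReal ε := by
  refine (meas_ge_le_lintegral_div (measurable_of_countable _).aemeasurable
    (ENNReal.ofReal_pos.2 (by positivity)).ne' ENNReal.ofReal_ne_top).trans ?_
  rw [lintegral_exp_renyi hM hα, ← ENNReal.ofReal_one,
    ← ENNReal.ofReal_div_of_pos (by positivity)]
  simp

/-- Markov's inequality suffices to control the total of the coefficients `b`, because the ball
radius, hence the factor `K`, may be taken of order `ε ^ 3`. -/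
lemma dataLaw_large_coefB_le {m_max s K ε : ℝ} (hM : ∀ i, 0 < M.size i ∧ M.size i ≤ m_max)
    (hs : 0 < s) {β₀ : EuclideanSpace ℝ (Fin p)}
    (hX : ∀ i, s ≤ Real.sigmoid (inner ℝ (X i) β₀)) (hn : 0 < n) (hε : 0 < ε) (hK : 0 ≤ K)
    (hKε : K * (2 ^ m_max * (2 / s) + m_max) ≤ ε ^ 3) :
    dataLaw M X β₀ {y | n * ε ^ 2 ≤ K * ∑ i, M.coefB i (y i)} ≤ ENNReal.ofReal ε := by
  have hn' : (0 : ℝ) < n := Nat.cast_pos.2 hn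
  have hpos : 0 < (n : ℝ) * ε ^ 2 := by positivity
  calc dataLaw M X β₀ {y | n * ε ^ 2 ≤ K * ∑ i, M.coefB i (y i)}
      ≤ dataLaw M X β₀ {y | ENNReal.ofReal (n * ε ^ 2)
          ≤ ENNReal.ofReal K * ENNReal.ofReal (∑ i, M.coefB i (y i))} := by
        refine measure_mono fun y hy => ?_
        rw [mem_ofPred_eq, ← ENNReal.ofReal_mul hK]
        exact ENNReal.ofReal_le_ofReal hy
    _ ≤ (∫⁻ y, ENNReal.ofReal K * ENNReal.ofReal (∑ i, M.coefB i (y i)) ∂(dataLaw M X β₀))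
          / ENNReal.ofReal (n * ε ^ 2) :=
        meas_ge_le_lintegral_div (measurable_of_countable _).aemeasurable
          (ENNReal.ofReal_pos.2 hpos).ne' ENNReal.ofReal_ne_top
    _ ≤ ENNReal.ofReal (n * ε ^ 3) / ENNReal.ofReal (n * ε ^ 2) := by
        gcongr
        rw [lintegral_const_mul' _ _ ENNReal.ofReal_ne_top]
        calc _ ≤ ENNReal.ofReal K * (n * ENNReal.ofReal (2 ^ m_max * (2 / s) + m_max)) := by
              gcongr
              exact lintegral_sum_coefB_le hM hs hX
          _ = ENNReal.ofReal (n * (K * (2 ^ m_max * (2 / s) + m_max))) := by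
              rw [ENNReal.ofReal_mul hn'.le, ENNReal.ofReal_mul hK, ENNReal.ofReal_natCast]
              ring
          _ ≤ _ := ENNReal.ofReal_le_ofReal (mul_le_mul_of_nonneg_left hKε hn'.le)
    _ = ENNReal.ofReal ε := by
        rw [← ENNReal.ofReal_div_of_pos hpos]
        congr 1
        field_simp

end SSG

theorem theorem4 (p : ℕ) (hp : 1 ≤ p) (μ : EuclideanSpace ℝ (Fin p))
    (S : Matrix (Fin p) (Fin p) ℝ) (hS : S.PosDef) (β₀ : EuclideanSpace ℝ (Fin p))
    (R m_max : ℝ) :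
    ∃ C₂ : ℝ, 0 < C₂ ∧
      ∀ (n : ℕ), 1 ≤ n →
      ∀ X : Fin n → EuclideanSpace ℝ (Fin p), (∀ i, ‖X i‖ ≤ R) →
      ∀ M : SSG.CountModel n, (∀ i, 0 < M.size i ∧ M.size i ≤ m_max) →
      ∀ α ∈ Set.Ioo (0 : ℝ) 1, ∀ ε ∈ Set.Ioo (0 : ℝ) (1 / 3), ∀ D : ℝ, 1 < D →
        1 - 2 * ε - ((D - 1) ^ 2 * n * ε ^ 2)⁻¹ ≤
          (SSG.dataLaw M X β₀).real
            {y | (∃ ξ, SSG.IsOptimal α (multivariateGaussian μ S) M X y ξ) ∧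
              ∀ ξ, SSG.IsOptimal α (multivariateGaussian μ S) M X y ξ →
                Integrable (fun β => SSG.renyiDiv α M X β β₀)
                  (SSG.posterior α (multivariateGaussian μ S) M X y ξ) ∧
                (1 - α) * ∫ β, SSG.renyiDiv α M X β β₀
                    ∂(SSG.posterior α (multivariateGaussian μ S) M X y ξ) ≤
                  D * α * ε ^ 2 + p * Real.log p / n + C₂ * (p / n) * Real.log (1 / ε)} := by
  obtain ⟨κ, hκ0, hκ⟩ := SSG.multivariateGaussian_ball_ge μ hS β₀
  set s := Real.sigmoid (-(|R| * ‖β₀‖)) with hs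
  have hs0 : 0 < s := Real.sigmoid_pos _
  -- `Kb` bounds the mean of `b`, and `Kl * r` the decrease of the exponent on a ball of radius `r`
  set Kb : ℝ := 2 ^ |m_max| * (2 / s) + |m_max| with hKb
  set Kl : ℝ := (1 / 2 + (2 * |R| * ‖β₀‖ + |R|) / 8) * |R| with hKl
  have hKb0 : 0 ≤ Kb := by positivity
  have hKl0 : 0 ≤ Kl := by positivity
  set c := (Kl * Kb + 1)⁻¹ with hc
  have hc0 : 0 < c := by positivity
  have hc1 : c ≤ 1 := inv_le_one_of_one_le₀ (by nlinarith)
  have hcK : Kl * c * Kb ≤ 1 := by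
    have : Kl * c * Kb = (Kl * Kb) / (Kl * Kb + 1) := by rw [hc]; ring
    rw [this]
    exact div_le_one_of_le₀ (by linarith) (by positivity)
  refine ⟨4 + |Real.log (κ * c)|, by positivity, ?_⟩
  intro n hn X hX M hM α hα ε hε D hD
  have hn0 : (0 : ℝ) < n := by exact_mod_cast hn
  have hp1 : (1 : ℝ) ≤ p := by exact_mod_cast hp
  have hε0 := hε.1
  have hMpos : ∀ i, 0 < M.size i := fun i => (hM i).1
  have hX' : ∀ i, ‖X i‖ ≤ |R| := fun i => (hX i).trans (le_abs_self R)
  have hsX : ∀ i, s ≤ Real.sigmoid (inner ℝ (X i) β₀) := fun i => Real.sigmoid_le <| by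
    refine le_trans (neg_le_neg ?_) (neg_abs_le _)
    exact (abs_real_inner_le_norm _ _).trans
      (mul_le_mul_of_nonneg_right (hX' i) (norm_nonneg _))
  have := SSG.isProbabilityMeasure_dataLaw hMpos X β₀
  set π := multivariateGaussian μ S with hπ
  set r := c * ε ^ 3 with hr
  have hr0 : 0 < r := by positivity
  have hr1 : r ≤ 1 := mul_le_one₀ hc1 (by positivity) (pow_le_one₀ hε0.le (by linarith [hε.2]))
  have hball : 0 < π.real (Metric.ball β₀ r) :=
    (by positivity : 0 < (κ * r) ^ p).trans_le (hκ r ⟨hr0, hr1⟩)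
  set G := {y | (∃ ξ, SSG.IsOptimal α π M X y ξ) ∧
    ∀ ξ, SSG.IsOptimal α π M X y ξ →
      Integrable (fun β => SSG.renyiDiv α M X β β₀) (SSG.posterior α π M X y ξ) ∧
      (1 - α) * ∫ β, SSG.renyiDiv α M X β β₀ ∂(SSG.posterior α π M X y ξ) ≤
        D * α * ε ^ 2 + p * Real.log p / n
          + (4 + |Real.log (κ * c)|) * (p / n) * Real.log (1 / ε)} with hG
  set E₁ := {y : Fin n → ℕ | ∃ i, M.coef i (y i) = 0}
  set E₂ := {y | ENNReal.ofReal (1 / ε) ≤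
    ∫⁻ β, ENNReal.ofReal ((SSG.affinity α M X β β₀)⁻¹ *
      (SSG.kernelProd M X β y / SSG.kernelProd M X β₀ y) ^ α) ∂π}
  set E₃ := {y : Fin n → ℕ | n * ε ^ 2 ≤ Kl * r * ∑ i, M.coefB i (y i)}
  have hsub : Gᶜ ⊆ E₁ ∪ E₂ ∪ E₃ := by
    rw [compl_subset_comm]
    intro y hy
    simp only [mem_compl_iff, mem_union, not_or] at hy
    obtain ⟨⟨hy₁, hy₂⟩, hy₃⟩ := hy
    have hy₁' : ∀ i, M.coef i (y i) ≠ 0 := fun i hi => hy₁ ⟨i, hi⟩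
    have hab : ∀ i, M.coefA i (y i) ≤ M.coefB i (y i) := fun i =>
      SSG.coefA_le_coefB _ (hy₁' i)
    refine ⟨SSG.exists_isOptimal hα.1 (fun i => SSG.coefA_nonneg (hMpos i) _) hab
      fun i => SSG.coefB_pos (hMpos i) _, fun ξ hξ => ?_⟩
    have hmain := SSG.posterior_risk_le (E := 1 / ε) (W := n * ε ^ 2) hn hMpos hα hab
      (abs_nonneg R) hX' hr1 hball (by positivity) (not_le.1 hy₂).le
      (by rw [← mul_assoc]; exact (not_le.1 hy₃).le) hξ
    refine ⟨hmain.1, hmain.2.trans ?_⟩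
    set l := Real.log (1 / ε) with hl
    have hl1 : 1 ≤ l := by
      rw [hl, Real.le_log_iff_exp_le (by positivity)]
      have := Real.exp_one_lt_d9
      have : 3 ≤ 1 / ε := by
        rw [le_div_iff₀ hε0]
        linarith [hε.2]
      linarith
    have hlogball : p * (Real.log (κ * c) - 3 * l) ≤ Real.log (π.real (Metric.ball β₀ r)) := by
      have h1 := Real.log_le_log (by positivity) (hκ r ⟨hr0, hr1⟩)
      refine le_trans (le_of_eq ?_) h1
      rw [Real.log_pow, hr, ← mul_assoc,
        Real.log_mul (x := κ * c) (y := ε ^ 3) (by positivity) (by positivity),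
        Real.log_pow, hl, one_div, Real.log_inv]
      push_cast
      ring
    have hplog : 0 ≤ p * Real.log p / n := by
      have := Real.log_nonneg hp1
      positivity
    have hDα : α * ε ^ 2 ≤ D * α * ε ^ 2 := by
      have : 0 < α * ε ^ 2 := mul_pos hα.1 (by positivity)
      nlinarith
    have hnum : l - Real.log (π.real (Metric.ball β₀ r))
        ≤ (4 + |Real.log (κ * c)|) * p * l := by
      have h1 : l ≤ p * l := le_mul_of_one_le_left (by linarith) hp1
      have h2 : -(p * Real.log (κ * c)) ≤ p * (|Real.log (κ * c)| * l) := by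
        rw [← mul_neg]
        refine mul_le_mul_of_nonneg_left ?_ (by linarith)
        exact (neg_le_abs _).trans (le_mul_of_one_le_right (abs_nonneg _) hl1)
      linarith
    calc (l + α * (n * ε ^ 2) - Real.log (π.real (Metric.ball β₀ r))) / n
        = α * ε ^ 2 + (l - Real.log (π.real (Metric.ball β₀ r))) / n := by
          field_simp
          ring
      _ ≤ α * ε ^ 2 + (4 + |Real.log (κ * c)|) * p * l / n := by gcongr
      _ = α * ε ^ 2 + (4 + |Real.log (κ * c)|) * (p / n) * l := by ring
      _ ≤ _ := by linarith
  have hKε : Kl * r * Kb ≤ ε ^ 3 := by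
    have : Kl * r * Kb = Kl * c * Kb * ε ^ 3 := by rw [hr]; ring
    rw [this]
    exact mul_le_of_le_one_left (by positivity) hcK
  have hGc : SSG.dataLaw M X β₀ Gᶜ ≤ ENNReal.ofReal (2 * ε) := by
    calc SSG.dataLaw M X β₀ Gᶜ ≤ SSG.dataLaw M X β₀ E₁ + SSG.dataLaw M X β₀ E₂
          + SSG.dataLaw M X β₀ E₃ :=
          (measure_mono hsub).trans <| (measure_union_le _ _).trans <|
            add_le_add_left (measure_union_le _ _) _
      _ ≤ 0 + ENNReal.ofReal ε + ENNReal.ofReal ε :=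
          add_le_add (add_le_add (SSG.dataLaw_impossible hMpos β₀).le
            (SSG.dataLaw_large_moment_le hMpos hα π β₀ hε0))
            (SSG.dataLaw_large_coefB_le
              (fun i => ⟨(hM i).1, (hM i).2.trans (le_abs_self _)⟩) hs0 hsX hn
              hε0 (by positivity) hKε)
      _ = ENNReal.ofReal (2 * ε) := by
          rw [zero_add, ← ENNReal.ofReal_add hε0.le hε0.le, two_mul]
  have hGmeas : MeasurableSet G := G.to_countable.measurableSet
  have hGr : (SSG.dataLaw M X β₀).real Gᶜ ≤ 2 * ε :=
    ENNReal.toReal_le_of_le_ofReal (by positivity) hGc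
  rw [probReal_compl_eq_one_sub hGmeas] at hGr
  have hinv : 0 ≤ ((D - 1) ^ 2 * n * ε ^ 2)⁻¹ := by positivity
  linarith
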